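/- Let $\mathbb D=\{z\in\mathbb C:|z|<1\}$, let $dA=\pi^{-1}dx\,dy$ be normalized area measure on $\mathbb D$, and let $\mathcal H$ be the space of analytic functions on $\mathbb D$ with the topology of uniform convergence on compact sets. A radial weight is a non-negative $dA$-integrable function $\omega$ on $\mathbb D$ with $\omega(z)=\omega(|z|)$ such that $\widehat\omega(r)=\int_r^1\omega(s)\,ds$ is non-zero for $0\le r<1$. It belongs to the class $\mathcal D$ of two-sided doubling weights if there are constants $C>0$, $K>1$ and $C'>1$ such that, for all $0\le r<1$, $$\widehat\omega(r)\le C\,\widehat\omega\Big(\frac{1+r}2\Big)<\infty\qquad\text{and}\qquad \widehat\omega(r)\ge C'\,\widehat\omega\Big(1-\frac{1-r}{K}\Big).$$ Let $A^2_\omega$ be the space of $f\in\mathcal H$ with $\int_{\mathbb D}|f|^2\omega\,dA<\infty$. The Bergman kernel $B^\omega_z\in A^2_\omega$ is determined by $f(z)=\int_{\mathbb D}f(\xi)\overline{B^\omega_z(\xi)}\,\omega(\xi)\,dA(\xi)$ for all $f\in A^2_\omega$, and the Bergman projection is $$P_\omega f(z)=\int_{\mathbb D}f(\xi)\overline{B^\omega_z(\xi)}\,\omega(\xi)\,dA(\xi),\qquad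 z\in\mathbb D.$$ For $\alpha>0$ put $\omega_\alpha(z)=(1-|z|)^\alpha\omega(z)$, and let $R^{\omega,\omega_\alpha}:\mathcal H\to\mathcal H$ be the unique continuous linear operator that satisfies $R^{\omega,\omega_\alpha}B^\omega_z=B^{\omega_\alpha}_z$ for all $z\in\mathbb D$ and commutes with the dilatations $f\mapsto f_r$, $f_r(z)=f(rz)$, $0<r<1$. The Bloch space $\mathcal B$ consists of the $f\in\mathcal H$ with $\|f\|_{\mathcal B}=\sup_{z\in\mathbb D}(1-|z|^2)|f'(z)|+|f(0)|<\infty$. **Theorem.** Let $\omega\in\mathcal D$. Then the integral defining $P_\omega\Phi(z)$ converges absolutely for all $\Phi\in L^\infty(\mathbb D,dA)$ and $z\in\mathbb D$, and $P_\omega$ is a linear operator from $L^\infty(\mathbb D,dA)$ onto $\mathcal B$ that is bounded: there is a constant $C$ with $\|P_\omega\Phi\|_{\mathcal B}\le C\|\Phi\|_\infty$ for all $\Phi\in L^\infty(\mathbb D,dA)$. Moreover, for every $\alpha>0$ and every $h\in\mathcal B$, the function $$g_\alpha(z)=(1-|z|)^\alpha R^{\omega,\omega_\alpha}h(z)$$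 belongs to $L^\infty(\mathbb D,dA)$ and $P_\omega g_\alpha=h$. -/

import Mathlib

open MeasureTheory Set
open scoped ENNReal ComplexConjugate

noncomputable section

namespace BergmanBloch

/-- The open unit disk `𝔻 = {|z| < 1}` as a type. -/
abbrev Disk : Type := ↥(Metric.ball (0 : ℂ) 1)

/-- The centre of the disk. -/
def origin : Disk := ⟨0, Metric.mem_ball_self one_pos⟩

/-- The normalized area measure `dA = π⁻¹ dx dy` on the disk. -/
def dA : Measure Disk :=
  ENNReal.ofReal Real.pi⁻¹ • Measure.comap (Subtype.val : Disk → ℂ) volume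

/-- Extension by zero of a function on the disk to the complex plane. -/
def extend (f : Disk → ℂ) (z : ℂ) : ℂ :=
  open Classical in if h : z ∈ Metric.ball (0 : ℂ) 1 then f ⟨z, h⟩ else 0

theorem extend_coe (f : Disk → ℂ) (z : Disk) : extend f (z : ℂ) = f z := by
  simp only [extend, dif_pos z.2]

theorem extend_of_mem (f : Disk → ℂ) {z : ℂ} (h : z ∈ Metric.ball (0 : ℂ) 1) :
    extend f z = f ⟨z, h⟩ := by
  simp only [extend, dif_pos h]

/-- The space `𝓗` of analytic functions on the disk. As a subspace of `C(𝔻, ℂ)` with the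
compact-open topology it carries the topology of uniform convergence on compact sets. -/
def Hol : Submodule ℂ C(Disk, ℂ) where
  carrier := {f | DifferentiableOn ℂ (extend f) (Metric.ball (0 : ℂ) 1)}
  add_mem' := by
    intro f g hf hg
    refine (DifferentiableOn.add hf hg).congr fun z hz => ?_
    simp [extend_of_mem _ hz]
  zero_mem' := by
    refine (differentiableOn_const (0 : ℂ)).congr fun z hz => ?_
    simp [extend_of_mem _ hz]
  smul_mem' := by
    intro c f hf
    refine (DifferentiableOn.const_smul hf c).congr fun z hz => ?_
    simp [extend_of_mem _ hz]

instance : CoeFun Hol fun _ => Disk → ℂ := ⟨fun f => f.1⟩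

/-- The complex derivative of a function on the disk. -/
def derivative (f : Disk → ℂ) (z : Disk) : ℂ := deriv (extend f) (z : ℂ)

/-- The point `r z` of the disk, for `0 < r < 1`. -/
def scale (r : Ioo (0 : ℝ) 1) (z : Disk) : Disk :=
  ⟨((r : ℝ) : ℂ) * (z : ℂ), by
    have hz : ‖(z : ℂ)‖ < 1 := mem_ball_zero_iff.1 z.2
    rw [mem_ball_zero_iff, norm_mul, Complex.norm_real, Real.norm_of_nonneg r.2.1.le]
    exact mul_lt_one_of_nonneg_of_lt_one_left r.2.1.le r.2.2 hz.le⟩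

theorem continuous_scale (r : Ioo (0 : ℝ) 1) : Continuous (scale r) := by
  unfold scale
  fun_prop

/-- The dilatation `f_r(z) = f(r z)` of an analytic function, `0 < r < 1`. -/
def dilate (r : Ioo (0 : ℝ) 1) (f : Hol) : Hol :=
  ⟨⟨fun z => f (scale r z), f.1.continuous.comp (continuous_scale r)⟩, by
    have hmaps : MapsTo (fun z : ℂ => ((r : ℝ) : ℂ) * z) (Metric.ball (0 : ℂ) 1)
        (Metric.ball (0 : ℂ) 1) := fun z hz => (scale r ⟨z, hz⟩).2
    have hd : DifferentiableOn ℂ (extend f) (Metric.ball (0 : ℂ) 1) := f.2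
    have hm : DifferentiableOn ℂ (fun z : ℂ => ((r : ℝ) : ℂ) * z) (Metric.ball (0 : ℂ) 1) :=
      (differentiable_id.const_mul _).differentiableOn
    refine (hd.comp hm hmaps).congr fun z hz => ?_
    rw [extend_of_mem _ hz, Function.comp_apply, extend_of_mem _ (hmaps hz)]
    rfl⟩

/-- `ω̂(r) = ∫_r^1 ω(s) ds`. -/
def hat (ω : ℝ → ℝ) (r : ℝ) : ℝ := ∫ s in r..1, ω s

/-- `ω : [0, 1) → ℝ` is (the radial profile of) a radial weight `z ↦ ω(|z|)`: it is non-negative,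
integrable over the disk, and `ω̂` does not vanish on `[0, 1)`. Since the integral of a
non-integrable function is `0` here, the last condition at `r = 0` also says that `ω̂(0)` is
finite; weights with `ω̂(0) = ∞` satisfy no upper doubling condition at `r = 0`. -/
structure IsRadialWeight (ω : ℝ → ℝ) : Prop where
  nonneg : ∀ r ∈ Ico (0 : ℝ) 1, 0 ≤ ω r
  integrable : Integrable (fun z : Disk => ω ‖(z : ℂ)‖) dA
  hat_ne_zero : ∀ r ∈ Ico (0 : ℝ) 1, hat ω r ≠ 0

/-- The upper doubling condition. -/
def UpperDoubling (ω : ℝ → ℝ) : Prop :=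
  ∃ C > (0 : ℝ), ∀ r ∈ Ico (0 : ℝ) 1, hat ω r ≤ C * hat ω ((1 + r) / 2)

/-- The lower doubling condition. -/
def LowerDoubling (ω : ℝ → ℝ) : Prop :=
  ∃ K > (1 : ℝ), ∃ C > (1 : ℝ), ∀ r ∈ Ico (0 : ℝ) 1, C * hat ω (1 - (1 - r) / K) ≤ hat ω r

/-- The class `𝓓` of two-sided doubling radial weights. -/
structure IsDoublingWeight (ω : ℝ → ℝ) : Prop where
  radialWeight : IsRadialWeight ω
  upper : UpperDoubling ω
  lower : LowerDoubling ω

/-- `ω_α(r) = (1 - r)^α ω(r)`. -/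
def powWeight (ω : ℝ → ℝ) (α : ℝ) (r : ℝ) : ℝ := (1 - r) ^ α * ω r

/-- Membership in the weighted Bergman space `A²_ω`. -/
def MemA2 (ω : ℝ → ℝ) (f : Hol) : Prop :=
  Integrable (fun ξ : Disk => ‖f ξ‖ ^ 2 * ω ‖(ξ : ℂ)‖) dA

/-- `K` is the reproducing kernel of `A²_ω` at `z`. -/
def IsBergmanKernel (ω : ℝ → ℝ) (z : Disk) (K : Hol) : Prop :=
  MemA2 ω K ∧
    ∀ f : Hol, MemA2 ω f → f z = ∫ ξ : Disk, f ξ * conj (K ξ) * (ω ‖(ξ : ℂ)‖ : ℂ) ∂dA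

/-- The Bergman kernel `B_z^ω`: the function in `A²_ω` with the reproducing property at `z`. -/
def bergmanKernel (ω : ℝ → ℝ) (z : Disk) : Hol := Classical.epsilon (IsBergmanKernel ω z)

/-- The integrand of the Bergman projection at `z`. -/
def projIntegrand (ω : ℝ → ℝ) (φ : Disk → ℂ) (z ξ : Disk) : ℂ :=
  φ ξ * conj (bergmanKernel ω z ξ) * (ω ‖(ξ : ℂ)‖ : ℂ)

/-- The Bergman projection `P_ω φ(z) = ∫ φ(ξ) conj(B_z^ω(ξ)) ω(ξ) dA(ξ)`. -/
def bergmanProj (ω : ℝ → ℝ) (φ : Disk → ℂ) (z : Disk) : ℂ :=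
  ∫ ξ : Disk, projIntegrand ω φ z ξ ∂dA

/-- The continuous linear operator `R : 𝓗 → 𝓗` commutes with dilatations and transforms the
Bergman kernels of `ω` into those of `ν`. -/
structure IsFracDeriv (ω ν : ℝ → ℝ) (R : Hol →L[ℂ] Hol) : Prop where
  dilate_comm : ∀ (r : Ioo (0 : ℝ) 1) (f : Hol), dilate r (R f) = R (dilate r f)
  map_kernel : ∀ z : Disk, R (bergmanKernel ω z) = bergmanKernel ν z

/-- The fractional derivative `R^{ω,ν}`: the operator characterized by `IsFracDeriv`. -/
def fracDeriv (ω ν : ℝ → ℝ) : Hol →L[ℂ] Hol := Classical.epsilon (IsFracDeriv ω ν)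

/-- Membership of an analytic function in the Bloch space. -/
def MemBloch (f : Hol) : Prop :=
  BddAbove (range fun z : Disk => (1 - ‖(z : ℂ)‖ ^ 2) * ‖derivative f z‖)

/-- The Bloch norm `sup_z (1 - |z|²)|f'(z)| + |f(0)|` of a Bloch function. -/
def blochNorm (f : Hol) : ℝ :=
  (⨆ z : Disk, (1 - ‖(z : ℂ)‖ ^ 2) * ‖derivative f z‖) + ‖f origin‖

/-- `g_α(z) = (1 - |z|)^α R^{ω,ω_α} h(z)`. -/
def gFun (ω : ℝ → ℝ) (α : ℝ) (h : Hol) (z : Disk) : ℂ :=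
  (((1 - ‖(z : ℂ)‖) ^ α : ℝ) : ℂ) * fracDeriv ω (powWeight ω α) h z

end BergmanBloch

end

open BergmanBloch

/-!
The Bergman kernel of `ω` has the expansion `B_z(ξ) = ∑ k_n (ξ z̄)^n` with `k_n = 1 / (2 ω_{2n+1})`,
where `ω_x = ∫₀¹ r^x ω(r) dr` are the moments of `ω`.

Upper doubling says `ω_n ≤ D ω_{2n+2}` for all `n`. The `L¹` means of a power series on circles are
controlled by writing it as `(1 - w)⁻¹` times the series of first differences of its coefficients,
followed by AM-GM and Parseval. On the circle of radius `r` this bounds the mean of `|∂_z B_z|` by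
`C / ((1 - t) ω̂(t)) ≤ C' ∑ t^n / ω_n`, where `t = r |z|`. Integrated termwise against `ω` in `r`,
the series becomes geometric in `|z|`, so `∫ |∂_z B_z| ω dA ≤ C / (1 - |z|)`. This is the
boundedness of `P_ω` from `L^∞` into the Bloch space.

The operator `R^{ω,ω_α}` multiplies the Taylor coefficients by `λ_n = ω_{2n+1} / (ω_α)_{2n+1}`, and
`R h(z) = R h(0) + z ∫ (1 - |ξ|²) h'(ξ) ∑ (n + 2) λ_{n+1} (z ξ̄)^n dA(ξ)`. By two-sided doubling
`λ_n ≤ C (n + 1)^α` and `|λ_{n+1} - λ_n| ≤ C (n + 1)^(α - 1)`, so the kernel has `L¹` norm at most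
`C (1 - |z|)^{-α}` and `g_α = (1 - |z|)^α R h` is bounded for Bloch functions `h`. Finally
`P_ω g_α = h` by comparing coefficients, since `k_n λ_n` are the kernel coefficients of `ω_α`.
-/

noncomputable section

namespace BergmanBloch

/-- The sum of the power series with coefficients `a`. It is `0` where the series diverges. -/
def seriesEval (a : ℕ → ℂ) (z : ℂ) : ℂ := ∑' n, a n * z ^ n

section PowerSeries

variable {a : ℕ → ℂ} {t : ℝ}

theorem summable_mul_pow_of_norm_le (ha : Summable fun n => ‖a n‖ * t ^ n) {z : ℂ}
    (hz : ‖z‖ ≤ t) : Summable fun n => a n * z ^ n := by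
  refine Summable.of_norm_bounded ha fun n => ?_
  rw [norm_mul, norm_pow]
  gcongr

theorem norm_seriesEval_le (ha : Summable fun n => ‖a n‖ * t ^ n) {z : ℂ} (hz : ‖z‖ ≤ t) :
    ‖seriesEval a z‖ ≤ ∑' n, ‖a n‖ * t ^ n := by
  refine tsum_of_norm_bounded ha.hasSum fun n => ?_
  rw [norm_mul, norm_pow]
  gcongr

theorem continuousOn_seriesEval (ha : Summable fun n => ‖a n‖ * t ^ n) :
    ContinuousOn (seriesEval a) (Metric.closedBall 0 t) := by
  refine continuousOn_tsum (fun n => by fun_prop) ha fun n z hz => ?_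
  have : ‖z‖ ≤ t := by simpa using hz
  rw [norm_mul, norm_pow]
  gcongr

theorem continuousOn_sphere_seriesEval (ht : 0 ≤ t) (ha : Summable fun n => ‖a n‖ * t ^ n) :
    ContinuousOn (seriesEval a) (Metric.sphere 0 |t|) :=
  (continuousOn_seriesEval ha).mono
    ((abs_of_nonneg ht).symm ▸ Metric.sphere_subset_closedBall)

end PowerSeries

section CircleAverage

open Real

variable {a : ℕ → ℂ} {t : ℝ}

theorem circleAverage_comp_mul_conj {E : Type*} [NormedAddCommGroup E] [NormedSpace ℝ E]
    (f : ℂ → E) (z : ℂ) (r : ℝ) :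
    circleAverage (fun ξ => f (z * conj ξ)) 0 r = circleAverage f 0 (‖z‖ * r) := by
  have rotate : ∀ θ, z * conj (circleMap 0 r θ) = circleMap 0 (‖z‖ * r) (z.arg - θ) := by
    intro θ
    nth_rw 1 [← Complex.norm_mul_exp_arg_mul_I z]
    simp only [circleMap, zero_add, map_mul, Complex.conj_ofReal, ← Complex.exp_conj,
      Complex.conj_I, Complex.ofReal_mul, Complex.ofReal_sub]
    rw [mul_mul_mul_comm, ← Complex.exp_add]
    congr 2
    ring
  have reflect := intervalIntegral.integral_comp_sub_left (a := 0) (b := 2 * π)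
    (fun θ => f (circleMap 0 (‖z‖ * r) (θ + (z.arg - 2 * π)))) (2 * π)
  rw [sub_self, sub_zero] at reflect
  rw [circleAverage_eq_integral_add (f := f) (z.arg - 2 * π), ← reflect, circleAverage_def]
  simp only [rotate]
  congr! 5
  ring

theorem circleAverage_pow_mul_conj_pow (k n : ℕ) (t : ℝ) :
    circleAverage (fun ξ : ℂ => ξ ^ k * conj ξ ^ n) 0 t
      = if k = n then (t : ℂ) ^ (2 * n) else 0 := by
  have on_circle : ∀ θ : ℝ, circleMap 0 t θ ^ k * conj (circleMap 0 t θ) ^ n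
      = (t : ℂ) ^ (k + n) * Complex.exp (((k - n : ℤ) : ℂ) * Complex.I * θ) := by
    intro θ
    have hconj : conj (circleMap 0 t θ) = t * Complex.exp (-(θ * Complex.I)) := by
      simp [circleMap, ← Complex.exp_conj]
    rw [hconj]
    simp only [circleMap, zero_add, mul_pow, ← Complex.exp_nat_mul]
    rw [mul_mul_mul_comm, ← pow_add, ← Complex.exp_add]
    congr 2
    push_cast
    ring
  simp only [circleAverage_def, on_circle, intervalIntegral.integral_const_mul]
  split_ifs with h
  · subst h
    simp [two_mul]
    field_simp
  · have hne : ((k - n : ℤ) : ℂ) * Complex.I ≠ 0 :=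
      mul_ne_zero (Int.cast_ne_zero.2 (by omega)) Complex.I_ne_zero
    have hperiod : Complex.exp (((k - n : ℤ) : ℂ) * Complex.I * ((2 * π : ℝ) : ℂ)) = 1 := by
      rw [← Complex.exp_int_mul_two_pi_mul_I (k - n)]
      congr 1
      push_cast
      ring
    rw [integral_exp_mul_complex hne, hperiod]
    simp

theorem hasSum_circleAverage {f : ℕ → ℂ → ℂ} {u : ℕ → ℝ} (hu : Summable u)
    (hf : ∀ n, ContinuousOn (f n) (Metric.sphere 0 |t|))
    (hfu : ∀ n, ∀ ξ : ℂ, ‖ξ‖ = |t| → ‖f n ξ‖ ≤ u n) :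
    HasSum (fun n => circleAverage (f n) 0 t) (circleAverage (fun ξ => ∑' n, f n ξ) 0 t) := by
  have hnorm : ∀ θ, ‖circleMap 0 t θ‖ = |t| := fun θ => by simp
  refine HasSum.const_smul _ (intervalIntegral.hasSum_integral_of_dominated_convergence
    (fun n _ => u n) (fun n => ((hf n).comp_continuous (continuous_circleMap 0 t)
      fun θ => by simp).aestronglyMeasurable) ?_ ?_ intervalIntegrable_const ?_)
  · exact fun n => .of_forall fun θ _ => hfu n _ (hnorm θ)
  · exact .of_forall fun θ _ => hu
  · exact .of_forall fun θ _ => (Summable.of_norm_bounded hu fun n => hfu n _ (hnorm θ)).hasSum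

theorem circleAverage_const_mul (c : ℂ) (f : ℂ → ℂ) :
    circleAverage (fun ξ => c * f ξ) 0 t = c * circleAverage f 0 t :=
  circleAverage_fun_smul (a := c)

theorem circleAverage_seriesEval_mul_conj_pow (ht : 0 ≤ t)
    (ha : Summable fun n => ‖a n‖ * t ^ n) (n : ℕ) :
    circleAverage (fun ξ => seriesEval a ξ * conj ξ ^ n) 0 t = a n * (t : ℂ) ^ (2 * n) := by
  have termwise := hasSum_circleAverage (t := t) (f := fun k ξ => a k * (ξ ^ k * conj ξ ^ n))
    (ha.mul_right (t ^ n)) (fun k => by fun_prop) (fun k ξ hξ => by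
      simp [hξ, abs_of_nonneg ht, mul_assoc])
  simp only [circleAverage_const_mul, circleAverage_pow_mul_conj_pow, mul_ite, mul_zero]
    at termwise
  have single := hasSum_single (f := fun k => if k = n then a k * (t : ℂ) ^ (2 * n) else 0) n
    fun k hk => if_neg hk
  simp only [if_true] at single
  rw [← termwise.unique single]
  simp only [seriesEval, ← tsum_mul_right, mul_assoc]

/-- Parseval's identity. -/
theorem hasSum_circleAverage_norm_seriesEval_sq (ht : 0 ≤ t)
    (ha : Summable fun n => ‖a n‖ * t ^ n) :
    HasSum (fun n => ‖a n‖ ^ 2 * t ^ (2 * n))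
      (circleAverage (fun ξ => ‖seriesEval a ξ‖ ^ 2) 0 t) := by
  have hcont := continuousOn_sphere_seriesEval ht ha
  have termwise := hasSum_circleAverage (t := t)
    (f := fun n ξ => conj (a n) * (seriesEval a ξ * conj ξ ^ n))
    (ha.mul_right (∑' k, ‖a k‖ * t ^ k)) (fun n => by fun_prop) (fun n ξ hξ => by
      rw [abs_of_nonneg ht] at hξ
      have := norm_seriesEval_le ha hξ.le
      simp only [norm_mul, RCLike.norm_conj, norm_pow, hξ]
      rw [mul_assoc, mul_comm ‖seriesEval a ξ‖]
      gcongr)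
  have coefficient : ∀ n, conj (a n) * (a n * (t : ℂ) ^ (2 * n))
      = ((‖a n‖ ^ 2 * t ^ (2 * n) : ℝ) : ℂ) := fun n => by
    rw [← mul_assoc, Complex.conj_mul']
    push_cast
    rfl
  have norm_sq : ∀ ξ, ∑' n, conj (a n) * (seriesEval a ξ * conj ξ ^ n)
      = Complex.ofRealCLM (‖seriesEval a ξ‖ ^ 2) := fun ξ => by
    rw [Complex.ofRealCLM_apply, Complex.ofReal_pow, ← Complex.mul_conj']
    nth_rw 3 [seriesEval]
    rw [Complex.conj_tsum, ← tsum_mul_left]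
    congr! 2 with n
    simp only [map_mul, map_pow]
    ring
  have real_average := Complex.ofRealCLM.circleAverage_comp_comm
    (f := fun ξ => ‖seriesEval a ξ‖ ^ 2) (hcont.norm.pow 2).circleIntegrable'
  simp only [circleAverage_const_mul, circleAverage_seriesEval_mul_conj_pow ht ha, coefficient,
    norm_sq] at termwise
  rw [← Complex.hasSum_ofReal]
  rwa [← Complex.ofRealCLM_apply (circleAverage _ _ _), ← real_average]

theorem circleAverage_norm_seriesEval_sq_le {Q : ℝ} (ht0 : 0 ≤ t) (ht1 : t < 1)
    (ha : Summable fun n => ‖a n‖ * t ^ n) (haQ : ∀ n, (‖a n‖ * t ^ n) ^ 2 ≤ Q ^ 2 * t ^ n) :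
    circleAverage (fun ξ => ‖seriesEval a ξ‖ ^ 2) 0 t ≤ Q ^ 2 / (1 - t) := by
  refine hasSum_le (fun n => ?_) (hasSum_circleAverage_norm_seriesEval_sq ht0 ha)
    ((hasSum_geometric_of_lt_one ht0 ht1).mul_left (Q ^ 2))
  calc ‖a n‖ ^ 2 * t ^ (2 * n) = (‖a n‖ * t ^ n) ^ 2 := by ring
    _ ≤ Q ^ 2 * t ^ n := haQ n

theorem circleAverage_norm_mul_le {f g : ℂ → ℂ} {Q : ℝ} (hQ : 0 < Q)
    (hf : ContinuousOn f (Metric.sphere 0 |t|)) (hg : ContinuousOn g (Metric.sphere 0 |t|)) :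
    circleAverage (fun ξ => ‖f ξ * g ξ‖) 0 t
      ≤ Q / 2 * circleAverage (fun ξ => ‖f ξ‖ ^ 2) 0 t
        + Q⁻¹ / 2 * circleAverage (fun ξ => ‖g ξ‖ ^ 2) 0 t := by
  have hfi : CircleIntegrable (fun ξ => (Q / 2) • ‖f ξ‖ ^ 2) 0 t :=
    (hf.norm.pow 2).circleIntegrable'.const_fun_smul
  have hgi : CircleIntegrable (fun ξ => (Q⁻¹ / 2) • ‖g ξ‖ ^ 2) 0 t :=
    (hg.norm.pow 2).circleIntegrable'.const_fun_smul
  rw [← smul_eq_mul, ← smul_eq_mul, ← circleAverage_fun_smul, ← circleAverage_fun_smul,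
    ← circleAverage_fun_add hfi hgi]
  refine circleAverage_mono (hf.mul hg).norm.circleIntegrable' (hfi.add hgi) fun ξ _ => ?_
  have square : Q / 2 * ‖f ξ‖ ^ 2 + Q⁻¹ / 2 * ‖g ξ‖ ^ 2 - ‖f ξ * g ξ‖
      = Q⁻¹ / 2 * (Q * ‖f ξ‖ - ‖g ξ‖) ^ 2 := by
    rw [norm_mul]
    field_simp
    ring
  have : 0 ≤ Q⁻¹ / 2 * (Q * ‖f ξ‖ - ‖g ξ‖) ^ 2 := by positivity
  simp only [smul_eq_mul]
  linarith

end CircleAverage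

section FirstDifferences

variable {a : ℕ → ℂ}

/-- The sequence of first differences `a n - a (n - 1)`, with the convention `a (-1) = 0`: the
coefficients of `(1 - z) * ∑ a n z ^ n`. -/
def firstDiff (a : ℕ → ℂ) : ℕ → ℂ
  | 0 => a 0
  | n + 1 => a (n + 1) - a n

theorem hasSum_firstDiff_mul_pow {z : ℂ} (ha : Summable fun n => a n * z ^ n) :
    HasSum (fun n => firstDiff a n * z ^ n) ((1 - z) * seriesEval a z) := by
  have shifted : HasSum (fun n => a (n + 1) * z ^ (n + 1)) (seriesEval a z - a 0) := by
    simpa [seriesEval] using (hasSum_nat_add_iff' 1).2 ha.hasSum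
  have tail := shifted.sub (ha.hasSum.mul_left z)
  have : HasSum (fun n => firstDiff a (n + 1) * z ^ (n + 1)) ((1 - z) * seriesEval a z - a 0) := by
    rw [show (1 - z) * seriesEval a z - a 0 = seriesEval a z - a 0 - z * seriesEval a z by ring]
    refine tail.congr_fun fun n => ?_
    simp only [firstDiff]
    ring
  simpa [firstDiff] using (hasSum_nat_add_iff (f := fun n => firstDiff a n * z ^ n) 1).1 this

theorem summable_norm_firstDiff_mul_pow {t : ℝ} (ht : 0 ≤ t)
    (ha : Summable fun n => ‖a n‖ * t ^ n) : Summable fun n => ‖firstDiff a n‖ * t ^ n := by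
  have hs : Summable fun n => a n * (t : ℂ) ^ n :=
    summable_mul_pow_of_norm_le ha (by simp [abs_of_nonneg ht])
  simpa [abs_of_nonneg ht] using (hasSum_firstDiff_mul_pow hs).summable.norm

theorem seriesEval_eq_geometric_mul_firstDiff {z : ℂ} (hz : ‖z‖ < 1)
    (ha : Summable fun n => a n * z ^ n) :
    seriesEval a z = seriesEval 1 z * seriesEval (firstDiff a) z := by
  have hne : 1 - z ≠ 0 := fun h => by simp [← sub_eq_zero.1 h] at hz
  have geometric : seriesEval 1 z = (1 - z)⁻¹ := by
    simpa [seriesEval] using tsum_geometric_of_norm_lt_one hz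
  rw [geometric, seriesEval, seriesEval, (hasSum_firstDiff_mul_pow ha).tsum_eq, seriesEval,
    inv_mul_cancel_left₀ hne]

theorem circleAverage_norm_seriesEval_le {t Q : ℝ} (ht0 : 0 ≤ t) (ht1 : t < 1) (hQ : 0 < Q)
    (ha : Summable fun n => ‖a n‖ * t ^ n)
    (haQ : ∀ n, (‖firstDiff a n‖ * t ^ n) ^ 2 ≤ Q ^ 2 * t ^ n) :
    Real.circleAverage (fun ξ => ‖seriesEval a ξ‖) 0 t ≤ Q / (1 - t) := by
  have hone : Summable fun n => ‖(1 : ℕ → ℂ) n‖ * t ^ n := by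
    simpa using summable_geometric_of_lt_one ht0 ht1
  have hdiff := summable_norm_firstDiff_mul_pow ht0 ha
  have factor : EqOn (fun ξ => ‖seriesEval a ξ‖)
      (fun ξ => ‖seriesEval 1 ξ * seriesEval (firstDiff a) ξ‖) (Metric.sphere 0 |t|) := by
    intro ξ hξ
    have hξt : ‖ξ‖ = t := by simpa [abs_of_nonneg ht0] using hξ
    simp only [seriesEval_eq_geometric_mul_firstDiff (hξt.trans_lt ht1)
      (summable_mul_pow_of_norm_le ha hξt.le)]
  have geometric := circleAverage_norm_seriesEval_sq_le (Q := 1) ht0 ht1 hone fun n => by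
    simpa [← pow_mul] using pow_le_pow_of_le_one ht0 ht1.le (show n ≤ n * 2 by omega)
  have difference := circleAverage_norm_seriesEval_sq_le ht0 ht1 hdiff haQ
  have : 0 < 1 - t := sub_pos.2 ht1
  calc Real.circleAverage (fun ξ => ‖seriesEval a ξ‖) 0 t
      = Real.circleAverage (fun ξ => ‖seriesEval 1 ξ * seriesEval (firstDiff a) ξ‖) 0 t :=
        Real.circleAverage_congr_sphere factor
    _ ≤ Q / 2 * (1 ^ 2 / (1 - t)) + Q⁻¹ / 2 * (Q ^ 2 / (1 - t)) :=
        (circleAverage_norm_mul_le hQ (continuousOn_sphere_seriesEval ht0 hone)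
          (continuousOn_sphere_seriesEval ht0 hdiff)).trans (by gcongr)
    _ = Q / (1 - t) := by
        field_simp
        norm_num

end FirstDifferences

theorem rpow_le_rpow_self_mul_exp {β x : ℝ} (hβ : 0 ≤ β) (hx : 0 ≤ x) :
    x ^ β ≤ β ^ β * Real.exp (x - β) := by
  rcases hβ.eq_or_lt with rfl | hβ
  · simpa using hx
  have tangent : x / β ≤ Real.exp (x / β - 1) := by
    linarith [Real.add_one_le_exp (x / β - 1)]
  calc x ^ β = β ^ β * (x / β) ^ β := by
        rw [← Real.mul_rpow hβ.le (by positivity), mul_div_cancel₀ _ hβ.ne']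
    _ ≤ β ^ β * Real.exp (x / β - 1) ^ β := by gcongr
    _ = β ^ β * Real.exp (x - β) := by
        rw [← Real.exp_mul]
        congr 2
        field_simp

theorem rpow_mul_pow_mul_one_sub_rpow_le {β t : ℝ} (hβ : 0 ≤ β) (n : ℕ) (ht0 : 0 ≤ t)
    (ht1 : t ≤ 1) :
    ((n : ℝ) + 1) ^ β * (t ^ n * (1 - t) ^ β) ≤ β ^ β * Real.exp (1 - β) := by
  have hx : 0 ≤ ((n : ℝ) + 1) * (1 - t) := mul_nonneg (by positivity) (sub_nonneg.2 ht1)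
  have hpow : t ^ n ≤ Real.exp (n * (t - 1)) := by
    rw [Real.exp_nat_mul]
    exact pow_le_pow_left₀ ht0 (by linarith [Real.add_one_le_exp (t - 1)]) n
  calc ((n : ℝ) + 1) ^ β * (t ^ n * (1 - t) ^ β)
      = t ^ n * (((n : ℝ) + 1) * (1 - t)) ^ β := by
        rw [Real.mul_rpow (by positivity) (sub_nonneg.2 ht1)]
        ring
    _ ≤ Real.exp (n * (t - 1)) * (β ^ β * Real.exp (((n : ℝ) + 1) * (1 - t) - β)) := by
        gcongr
        exact rpow_le_rpow_self_mul_exp hβ hx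
    _ = β ^ β * Real.exp (1 - t - β) := by
        rw [mul_left_comm, ← Real.exp_add]
        ring_nf
    _ ≤ β ^ β * Real.exp (1 - β) := by
        gcongr
        linarith

/-- The moment `∫_0^1 r^n W(r) dr` of a radial weight. -/
def moment (W : ℝ → ℝ) (n : ℕ) : ℝ := ∫ r in (0 : ℝ)..1, r ^ n * W r

/-- Doubling of moments: the form in which the upper doubling condition is used. The summand `2`
makes the condition meaningful at `n = 0`. -/
def DoublingMoments (W : ℝ → ℝ) (D : ℝ) : Prop := ∀ n, moment W n ≤ D * moment W (2 * n + 2)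

/-- The measure `W(r) dr` on `(0, 1)`. -/
def radialMeasure (W : ℝ → ℝ) : Measure ℝ :=
  (volume.restrict (Ioo 0 1)).withDensity fun r => ENNReal.ofReal (W r)

theorem ae_mem_radialMeasure (W : ℝ → ℝ) : ∀ᵐ r ∂radialMeasure W, r ∈ Ioo (0 : ℝ) 1 :=
  (withDensity_absolutelyContinuous _ _).ae_le (ae_restrict_mem measurableSet_Ioo)

namespace IsRadialWeight

variable {W : ℝ → ℝ} {t : ℝ}

theorem intervalIntegrable (hW : IsRadialWeight W) : IntervalIntegrable W volume 0 1 := by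
  by_contra h
  exact hW.hat_ne_zero 0 (by simp) (intervalIntegral.integral_undef h)

theorem integrableOn (hW : IsRadialWeight W) : IntegrableOn W (Ioo 0 1) :=
  (intervalIntegrable_iff_integrableOn_Ioo_of_le zero_le_one).1 hW.intervalIntegrable

theorem intervalIntegrable_mul (hW : IsRadialWeight W) {g : ℝ → ℝ} (hg : Continuous g) {a b : ℝ}
    (ha : a ∈ Icc (0 : ℝ) 1) (hb : b ∈ Icc (0 : ℝ) 1) :
    IntervalIntegrable (fun r => g r * W r) volume a b := by
  refine (hW.intervalIntegrable.mono_set ?_).continuousOn_mul hg.continuousOn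
  rw [uIcc_of_le (zero_le_one' ℝ)]
  exact uIcc_subset_Icc ha hb

theorem integral_mul_mono (hW : IsRadialWeight W) {g h : ℝ → ℝ} (hg : Continuous g)
    (hh : Continuous h) {a b : ℝ} (ha : 0 ≤ a) (hab : a ≤ b) (hb : b ≤ 1)
    (hgh : ∀ r ∈ Ioo a b, g r ≤ h r) :
    ∫ r in a..b, g r * W r ≤ ∫ r in a..b, h r * W r :=
  intervalIntegral.integral_mono_on_of_le_Ioo hab
    (hW.intervalIntegrable_mul hg ⟨ha, hab.trans hb⟩ ⟨ha.trans hab, hb⟩)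
    (hW.intervalIntegrable_mul hh ⟨ha, hab.trans hb⟩ ⟨ha.trans hab, hb⟩) fun r hr =>
      mul_le_mul_of_nonneg_right (hgh r hr) (hW.nonneg r ⟨ha.trans hr.1.le, hr.2.trans_le hb⟩)

theorem integral_mul_nonneg (hW : IsRadialWeight W) {g : ℝ → ℝ} (hg : Continuous g)
    {a b : ℝ} (ha : 0 ≤ a) (hab : a ≤ b) (hb : b ≤ 1) (hg0 : ∀ r ∈ Ioo a b, 0 ≤ g r) :
    0 ≤ ∫ r in a..b, g r * W r := by
  simpa using hW.integral_mul_mono (g := fun _ => 0) continuous_const hg ha hab hb hg0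

theorem integral_mul_split (hW : IsRadialWeight W) {g : ℝ → ℝ} (hg : Continuous g)
    (ht : t ∈ Icc (0 : ℝ) 1) :
    ∫ r in (0 : ℝ)..1, g r * W r = (∫ r in (0 : ℝ)..t, g r * W r) + ∫ r in t..1, g r * W r :=
  (intervalIntegral.integral_add_adjacent_intervals
    (hW.intervalIntegrable_mul hg (by simp) ht)
    (hW.intervalIntegrable_mul hg ht (by simp))).symm

theorem hat_pos (hW : IsRadialWeight W) (ht : t ∈ Ico (0 : ℝ) 1) : 0 < hat W t := by
  refine lt_of_le_of_ne ?_ (hW.hat_ne_zero t ht).symm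
  simpa [hat] using
    hW.integral_mul_nonneg (g := fun _ => 1) continuous_const ht.1 ht.2.le le_rfl (by simp)

theorem pow_mul_hat_le_moment (hW : IsRadialWeight W) (ht : t ∈ Ico (0 : ℝ) 1) (n : ℕ) :
    t ^ n * hat W t ≤ moment W n := by
  obtain ⟨ht0, ht1⟩ := ht
  have left := hW.integral_mul_nonneg (continuous_pow n) le_rfl ht0 ht1.le
    fun r hr => pow_nonneg hr.1.le _
  have right := hW.integral_mul_mono (g := fun _ => t ^ n) continuous_const (continuous_pow n)
    ht0 ht1.le le_rfl fun r hr => pow_le_pow_left₀ ht0 hr.1.le _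
  rw [moment, hW.integral_mul_split (continuous_pow n) ⟨ht0, ht1.le⟩, hat,
    ← intervalIntegral.integral_const_mul]
  linarith

theorem moment_pos (hW : IsRadialWeight W) (n : ℕ) : 0 < moment W n := by
  have half : (1 / 2 : ℝ) ∈ Ico (0 : ℝ) 1 := by norm_num
  exact (mul_pos (by positivity) (hW.hat_pos half)).trans_le (hW.pow_mul_hat_le_moment half n)

theorem moment_antitone (hW : IsRadialWeight W) : Antitone (moment W) := fun _ _ h =>
  hW.integral_mul_mono (by fun_prop) (by fun_prop) le_rfl zero_le_one le_rfl
    fun _ hr => pow_le_pow_of_le_one hr.1.le hr.2.le h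

theorem moment_add_le (hW : IsRadialWeight W) (ht : t ∈ Ico (0 : ℝ) 1) (j k : ℕ) :
    moment W (j + k) ≤ t ^ j * moment W k + hat W t := by
  obtain ⟨ht0, ht1⟩ := ht
  have outer : ∫ r in t..1, r ^ (j + k) * W r ≤ hat W t := by
    simpa [hat] using hW.integral_mul_mono (h := fun _ => 1) (continuous_pow (j + k))
      continuous_const ht0 ht1.le le_rfl fun r hr => pow_le_one₀ (ht0.trans hr.1.le) hr.2.le
  have inner : ∫ r in (0 : ℝ)..t, r ^ (j + k) * W r ≤ t ^ j * ∫ r in (0 : ℝ)..t, r ^ k * W r := by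
    rw [← intervalIntegral.integral_const_mul]
    simp only [← mul_assoc]
    refine hW.integral_mul_mono (by fun_prop) (by fun_prop) le_rfl ht0 ht1.le fun r hr => ?_
    rw [pow_add]
    exact mul_le_mul_of_nonneg_right (pow_le_pow_left₀ hr.1.le hr.2.le _) (pow_nonneg hr.1.le _)
  have rest : 0 ≤ t ^ j * ∫ r in t..1, r ^ k * W r :=
    mul_nonneg (pow_nonneg ht0 _) (hW.integral_mul_nonneg (continuous_pow k) ht0 ht1.le le_rfl
      fun r hr => pow_nonneg (ht0.trans hr.1.le) _)
  rw [moment, hW.integral_mul_split (continuous_pow _) ⟨ht0, ht1.le⟩, moment,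
    hW.integral_mul_split (continuous_pow _) ⟨ht0, ht1.le⟩, mul_add]
  linarith

theorem radialMeasure_Ici (hW : IsRadialWeight W) (ht : t ∈ Ico (0 : ℝ) 1) :
    radialMeasure W (Ici t) = ENNReal.ofReal (hat W t) := by
  obtain ⟨ht0, ht1⟩ := ht
  have hIoo : Ioi t ∩ Ioo 0 1 = Ioo t 1 := by
    rw [Ioi_inter_Ioo, sup_of_le_left ht0]
  have hae : (Ici t ∩ Ioo 0 1 : Set ℝ) =ᵐ[volume] Ioo t 1 :=
    hIoo ▸ Ioi_ae_eq_Ici.symm.inter (ae_eq_refl _)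
  rw [radialMeasure, withDensity_apply _ measurableSet_Ici, Measure.restrict_restrict
    measurableSet_Ici, Measure.restrict_congr_set hae, hat,
    intervalIntegral.integral_of_le ht1.le, integral_Ioc_eq_integral_Ioo,
    ofReal_integral_eq_lintegral_ofReal]
  · exact hW.integrableOn.mono_set (Ioo_subset_Ioo_left ht0)
  · exact (ae_restrict_mem measurableSet_Ioo).mono fun r hr => hW.nonneg r ⟨ht0.trans hr.1.le, hr.2⟩

theorem lintegral_radialMeasure_pow (hW : IsRadialWeight W) (n : ℕ) :
    ∫⁻ r, ENNReal.ofReal (r ^ n) ∂radialMeasure W = ENNReal.ofReal (moment W n) := by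
  rw [radialMeasure, lintegral_withDensity_eq_lintegral_mul₀
    (hW.integrableOn.aestronglyMeasurable.aemeasurable.ennreal_ofReal) (by fun_prop), moment,
    intervalIntegral.integral_of_le zero_le_one, integral_Ioc_eq_integral_Ioo,
    ofReal_integral_eq_lintegral_ofReal]
  · refine setLIntegral_congr_fun measurableSet_Ioo fun r hr => ?_
    rw [ENNReal.ofReal_mul (pow_nonneg hr.1.le _), mul_comm, Pi.mul_apply]
  · exact (intervalIntegrable_iff_integrableOn_Ioo_of_le zero_le_one).1
      (hW.intervalIntegrable_mul (continuous_pow n) (by simp) (by simp))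
  · exact (ae_restrict_mem measurableSet_Ioo).mono fun r hr =>
      mul_nonneg (pow_nonneg hr.1.le _) (hW.nonneg r ⟨hr.1.le, hr.2⟩)

theorem radialMeasure_superlevel_pow_le (hW : IsRadialWeight W) {C : ℝ} (hC : 0 ≤ C)
    (hdouble : ∀ r ∈ Ico (0 : ℝ) 1, hat W r ≤ C * hat W ((1 + r) / 2)) {n : ℕ} (hn : n ≠ 0)
    {s : ℝ} (hs : 0 < s) :
    radialMeasure W {x | s ≤ x ^ n} ≤ ENNReal.ofReal C * radialMeasure W {x | s ≤ x ^ (2 * n)} := by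
  have hae := ae_mem_radialMeasure W
  rcases le_or_gt 1 s with hs1 | hs1
  · have : radialMeasure W {x | s ≤ x ^ n} = 0 :=
      measure_eq_zero_iff_ae_notMem.2 (hae.mono fun x hx hsx =>
        (hs1.trans hsx).not_gt (pow_lt_one₀ hx.1.le hx.2 hn))
    simp [this]
  · obtain ⟨t, ⟨ht0, ht1⟩, rfl⟩ : ∃ t ∈ Ico (0 : ℝ) 1, t ^ n = s :=
      ⟨s ^ (n : ℝ)⁻¹, ⟨by positivity, Real.rpow_lt_one hs.le hs1 (by positivity)⟩,
        Real.rpow_inv_natCast_pow hs.le hn⟩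
    calc radialMeasure W {x | t ^ n ≤ x ^ n} ≤ radialMeasure W (Ici t) :=
          measure_mono_ae (hae.mono fun x hx htx => le_of_pow_le_pow_left₀ hn hx.1.le htx)
      _ ≤ ENNReal.ofReal C * radialMeasure W (Ici ((1 + t) / 2)) := by
          rw [hW.radialMeasure_Ici ⟨ht0, ht1⟩, hW.radialMeasure_Ici ⟨by linarith, by linarith⟩,
            ← ENNReal.ofReal_mul hC]
          exact ENNReal.ofReal_le_ofReal (hdouble t ⟨ht0, ht1⟩)
      _ ≤ ENNReal.ofReal C * radialMeasure W {x | t ^ n ≤ x ^ (2 * n)} := by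
          gcongr
          intro x (hx : (1 + t) / 2 ≤ x)
          have hsq : t ≤ x ^ 2 := by nlinarith [sq_nonneg (x - 1)]
          exact (pow_le_pow_left₀ ht0 hsq n).trans_eq (pow_mul x 2 n).symm

theorem moment_le_mul_moment_two_mul (hW : IsRadialWeight W) {C : ℝ} (hC : 0 ≤ C)
    (hdouble : ∀ r ∈ Ico (0 : ℝ) 1, hat W r ≤ C * hat W ((1 + r) / 2)) {n : ℕ} (hn : n ≠ 0) :
    moment W n ≤ C * moment W (2 * n) := by
  have layer_cake : ∀ k, ENNReal.ofReal (moment W k)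
      = ∫⁻ s in Ioi 0, radialMeasure W {x | s ≤ x ^ k} := fun k => by
    rw [← hW.lintegral_radialMeasure_pow, lintegral_eq_lintegral_meas_le _
      ((ae_mem_radialMeasure W).mono fun x hx => pow_nonneg hx.1.le _) (by fun_prop)]
  rw [← ENNReal.ofReal_le_ofReal_iff (mul_nonneg hC (hW.moment_pos _).le),
    ENNReal.ofReal_mul hC, layer_cake, layer_cake, ← lintegral_const_mul' _ _ ENNReal.ofReal_ne_top]
  exact setLIntegral_mono' measurableSet_Ioi fun s hs =>
    hW.radialMeasure_superlevel_pow_le hC hdouble hn hs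

theorem exists_doublingMoments (hW : IsRadialWeight W) (hu : UpperDoubling W) :
    ∃ D, DoublingMoments W D := by
  obtain ⟨C, hC, hdouble⟩ := hu
  refine ⟨max (C * C) (moment W 0 / moment W 2), fun n => ?_⟩
  have hpos := hW.moment_pos (2 * n + 2)
  rcases eq_or_ne n 0 with rfl | hn
  · rw [← div_le_iff₀ hpos]
    exact le_max_right _ _
  · calc moment W n ≤ C * moment W (2 * n) := hW.moment_le_mul_moment_two_mul hC.le hdouble hn
      _ ≤ C * (C * moment W (2 * (2 * n))) := by
        gcongr
        exact hW.moment_le_mul_moment_two_mul hC.le hdouble (by omega)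
      _ ≤ C * (C * moment W (2 * n + 2)) := by
        gcongr
        exact hW.moment_antitone (by omega)
      _ ≤ _ := by
        rw [← mul_assoc]
        gcongr
        exact le_max_left _ _

theorem one_le_of_doublingMoments (hW : IsRadialWeight W) {D : ℝ} (hD : DoublingMoments W D) :
    1 ≤ D :=
  le_of_mul_le_mul_right
    (by simpa using (hW.moment_antitone (Nat.zero_le _)).trans (hD 0)) (hW.moment_pos (2 * 0 + 2))

theorem moment_two_mul_le_two_mul_hat (hW : IsRadialWeight W) {D : ℝ} (hD : DoublingMoments W D)
    (ht : t ∈ Ico (0 : ℝ) 1) {N : ℕ} (htN : t ^ N ≤ (2 * D)⁻¹) :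
    moment W (2 * N) ≤ 2 * hat W t := by
  have hD0 : 0 < D := zero_lt_one.trans_le (hW.one_le_of_doublingMoments hD)
  have near_zero : t ^ N * moment W N ≤ moment W (2 * N) / 2 :=
    calc t ^ N * moment W N ≤ (2 * D)⁻¹ * (D * moment W (2 * N)) :=
          mul_le_mul htN ((hD N).trans (by gcongr; exact hW.moment_antitone (by omega)))
            (hW.moment_pos _).le (by positivity)
      _ = moment W (2 * N) / 2 := by field_simp
  have := hW.moment_add_le ht N N
  rw [← two_mul] at this
  linarith

end IsRadialWeight

/-- Coefficients of a power series that converges in the unit disk. -/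
def SummableOnDisk (a : ℕ → ℂ) : Prop :=
  ∀ t : ℝ, 0 ≤ t → t < 1 → Summable fun n => ‖a n‖ * t ^ n

namespace SummableOnDisk

variable {a b : ℕ → ℂ}

theorem summable (ha : SummableOnDisk a) {z : ℂ} (hz : ‖z‖ < 1) :
    Summable fun n => a n * z ^ n :=
  summable_mul_pow_of_norm_le (ha ‖z‖ (norm_nonneg z) hz) le_rfl

theorem of_norm_le (ha : SummableOnDisk a) {C : ℝ} (h : ∀ n, ‖b n‖ ≤ C * ‖a n‖) :
    SummableOnDisk b := fun t ht0 ht1 => by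
  refine Summable.of_nonneg_of_le (fun n => by positivity) (fun n => ?_)
    ((ha t ht0 ht1).mul_left C)
  rw [← mul_assoc]
  exact mul_le_mul_of_nonneg_right (h n) (pow_nonneg ht0 n)

theorem mul (ha : SummableOnDisk a) (hb : SummableOnDisk b) :
    SummableOnDisk fun n => a n * b n := fun t ht0 ht1 => by
  have hs1 : √t < 1 := (Real.sqrt_lt' one_pos).2 (by simpa using ht1)
  have hbs := hb √t (Real.sqrt_nonneg t) hs1
  refine Summable.of_nonneg_of_le (fun n => by positivity) (fun n => ?_)
    ((ha √t (Real.sqrt_nonneg t) hs1).mul_right (∑' k, ‖b k‖ * √t ^ k))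
  calc ‖a n * b n‖ * t ^ n = ‖a n‖ * √t ^ n * (‖b n‖ * √t ^ n) := by
        rw [norm_mul, ← Real.sq_sqrt ht0, Real.sqrt_sq (Real.sqrt_nonneg t)]
        ring
    _ ≤ ‖a n‖ * √t ^ n * ∑' k, ‖b k‖ * √t ^ k := by
        gcongr
        exact hbs.le_tsum n fun k _ => by positivity

theorem shift (ha : SummableOnDisk a) : SummableOnDisk fun n => a (n + 1) := fun t ht0 ht1 => by
  rcases ht0.eq_or_lt with rfl | ht
  · exact summable_of_ne_finset_zero (s := {0}) fun n hn => by simp_all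
  · refine (((summable_nat_add_iff 1).2 (ha t ht0 ht1)).mul_left t⁻¹).congr fun n => ?_
    rw [pow_succ]
    field_simp

end SummableOnDisk

theorem summableOnDisk_rpow {β : ℝ} (hβ : 0 ≤ β) :
    SummableOnDisk fun n => ((((n : ℝ) + 1) ^ β : ℝ) : ℂ) := fun t ht0 ht1 => by
  have hs0 := Real.sqrt_nonneg t
  have hs1 : √t < 1 := (Real.sqrt_lt' one_pos).2 (by simpa using ht1)
  have hpos : 0 < (1 - √t) ^ β := Real.rpow_pos_of_pos (sub_pos.2 hs1) _
  refine Summable.of_nonneg_of_le (fun n => by positivity) (fun n => ?_)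
    ((summable_geometric_of_lt_one hs0 hs1).mul_left (β ^ β * Real.exp (1 - β) / (1 - √t) ^ β))
  rw [Complex.norm_real, Real.norm_of_nonneg (by positivity)]
  calc ((n : ℝ) + 1) ^ β * t ^ n
      = ((n : ℝ) + 1) ^ β * (√t ^ n * (1 - √t) ^ β) / (1 - √t) ^ β * √t ^ n := by
        nth_rw 1 [← Real.sq_sqrt ht0]
        field_simp
        ring
    _ ≤ β ^ β * Real.exp (1 - β) / (1 - √t) ^ β * √t ^ n := by
        exact mul_le_mul_of_nonneg_right (div_le_div_of_nonneg_right
          (rpow_mul_pow_mul_one_sub_rpow_le hβ n hs0 hs1.le) hpos.le) (by positivity)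

theorem continuous_one_sub_rpow {α : ℝ} (hα : 0 ≤ α) : Continuous fun r : ℝ => (1 - r) ^ α :=
  (continuous_const.sub continuous_id).rpow_const fun _ => Or.inr hα

theorem rpow_le_mul_rpow_of_le_mul {β c x y : ℝ} (hβ : 0 ≤ β) (hc : 0 ≤ c) (hx : 0 ≤ x)
    (hy : 0 ≤ y) (h : x ≤ c * y) : x ^ β ≤ c ^ β * y ^ β := by
  rw [← Real.mul_rpow hc hy]
  exact Real.rpow_le_rpow hx h hβ

theorem rpow_mul_pow_mul_one_sub_rpow_le_pow_half {β t : ℝ} (hβ : 0 ≤ β) (n : ℕ) (ht0 : 0 ≤ t)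
    (ht1 : t ≤ 1) :
    ((n : ℝ) + 1) ^ β * (t ^ n * (1 - t) ^ β)
      ≤ 2 ^ β * (β ^ β * Real.exp (1 - β)) * t ^ (n / 2) := by
  have : 0 ≤ (1 - t) ^ β := Real.rpow_nonneg (sub_nonneg.2 ht1) _
  have hn : (n : ℝ) + 1 ≤ 2 * (((n / 2 : ℕ) : ℝ) + 1) := by
    exact_mod_cast (by omega : n + 1 ≤ 2 * (n / 2 + 1))
  have hrpow : ((n : ℝ) + 1) ^ β ≤ 2 ^ β * (((n / 2 : ℕ) : ℝ) + 1) ^ β := by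
    rw [← Real.mul_rpow (by norm_num) (by positivity)]
    exact Real.rpow_le_rpow (by positivity) hn hβ
  have hpow : t ^ n ≤ t ^ (n / 2) * t ^ (n / 2) := by
    rw [← pow_add]
    exact pow_le_pow_of_le_one ht0 ht1 (by omega)
  calc ((n : ℝ) + 1) ^ β * (t ^ n * (1 - t) ^ β)
      ≤ (2 ^ β * (((n / 2 : ℕ) : ℝ) + 1) ^ β) * (t ^ (n / 2) * t ^ (n / 2) * (1 - t) ^ β) := by
        gcongr
    _ = 2 ^ β * ((((n / 2 : ℕ) : ℝ) + 1) ^ β * (t ^ (n / 2) * (1 - t) ^ β)) * t ^ (n / 2) := by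
        ring
    _ ≤ 2 ^ β * (β ^ β * Real.exp (1 - β)) * t ^ (n / 2) := by
        exact mul_le_mul_of_nonneg_right (mul_le_mul_of_nonneg_left
          (rpow_mul_pow_mul_one_sub_rpow_le hβ _ ht0 ht1) (by positivity)) (by positivity)

theorem exists_pow_succ_le_and_le_pow {t x : ℝ} (ht0 : 0 ≤ t) (ht1 : t < 1) (hx0 : 0 < x)
    (hx1 : x ≤ 1) : ∃ N : ℕ, t ^ (N + 1) ≤ x ∧ x ≤ t ^ N := by
  rcases ht0.eq_or_lt with rfl | ht0
  · exact ⟨0, by simpa using hx0.le, by simpa using hx1⟩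
  · obtain ⟨N, hN, hN'⟩ := exists_nat_pow_near_of_lt_one hx0 hx1 ht0 ht1
    exact ⟨N, hN.le, hN'⟩

/-- The coefficients of the Bergman kernel `B_z(ξ) = ∑ kernelCoeff W n * (conj z * ξ) ^ n`. -/
def kernelCoeff (W : ℝ → ℝ) (n : ℕ) : ℝ := (2 * moment W (2 * n + 1))⁻¹

/-- The multiplier of the fractional derivative `R^{W,V}` on Taylor coefficients. -/
def multiplier (W V : ℝ → ℝ) (n : ℕ) : ℝ := moment W (2 * n + 1) / moment V (2 * n + 1)

namespace IsRadialWeight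

variable {W : ℝ → ℝ} {t : ℝ}

theorem summable_pow_div_moment_mul_add (hW : IsRadialWeight W) {s : ℝ} (hs : s ∈ Ioo (0 : ℝ) 1)
    (ht : 0 ≤ t) (p q : ℕ) (hts : t < s ^ p) :
    Summable fun n => t ^ n / moment W (p * n + q) := by
  obtain ⟨hs0, hs1⟩ := hs
  have hhat := hW.hat_pos ⟨hs0.le, hs1⟩
  refine Summable.of_nonneg_of_le
    (fun n => div_nonneg (pow_nonneg ht n) (hW.moment_pos _).le) (fun n => ?_)
    ((summable_geometric_of_lt_one (by positivity) ((div_lt_one (by positivity)).2 hts)).mul_right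
      (s ^ q * hat W s)⁻¹)
  calc t ^ n / moment W (p * n + q) ≤ t ^ n / (s ^ (p * n + q) * hat W s) := by
        gcongr
        exact hW.pow_mul_hat_le_moment ⟨hs0.le, hs1⟩ _
    _ = (t / s ^ p) ^ n * (s ^ q * hat W s)⁻¹ := by
        rw [div_pow, ← pow_mul, pow_add]
        field_simp

theorem summable_pow_div_moment (hW : IsRadialWeight W) (ht : t ∈ Ico (0 : ℝ) 1) :
    Summable fun n => t ^ n / moment W n := by
  obtain ⟨s, hts, hs1⟩ := exists_between ht.2
  simpa using hW.summable_pow_div_moment_mul_add ⟨ht.1.trans_lt hts, hs1⟩ ht.1 1 0 (by simpa)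

theorem kernelCoeff_pos (hW : IsRadialWeight W) (n : ℕ) : 0 < kernelCoeff W n :=
  inv_pos.2 (mul_pos two_pos (hW.moment_pos _))

theorem summableOnDisk_kernelCoeff (hW : IsRadialWeight W) :
    SummableOnDisk fun n => (kernelCoeff W n : ℂ) := fun t ht0 ht1 => by
  obtain ⟨s, hts, hs1⟩ := exists_between ((Real.sqrt_lt' one_pos).2 (by simpa using ht1))
  have hs0 : 0 < s := (Real.sqrt_nonneg t).trans_lt hts
  refine ((hW.summable_pow_div_moment_mul_add ⟨hs0, hs1⟩ ht0 2 1
    ((Real.sqrt_lt' hs0).1 hts)).div_const 2).congr fun n => ?_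
  rw [Complex.norm_real, Real.norm_of_nonneg (hW.kernelCoeff_pos n).le, kernelCoeff]
  have := hW.moment_pos (2 * n + 1)
  field_simp

theorem moment_half_le (hW : IsRadialWeight W) {D : ℝ} (hD : DoublingMoments W D) (n : ℕ) :
    moment W (n / 2) ≤ D * moment W n :=
  (hD _).trans (mul_le_mul_of_nonneg_left (hW.moment_antitone (by omega))
    (zero_le_one.trans (hW.one_le_of_doublingMoments hD)))

theorem sq_pow_mul_hat_le (hW : IsRadialWeight W) {D : ℝ} (hD : DoublingMoments W D)
    (ht : t ∈ Ico (0 : ℝ) 1) (n : ℕ) :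
    (t ^ n * hat W t) ^ 2 ≤ (D ^ 2 * moment W (2 * n + 1)) ^ 2 * t ^ n := by
  have hD0 := zero_le_one.trans (hW.one_le_of_doublingMoments hD)
  have hhat := (hW.hat_pos ht).le
  have half : t ^ (n / 2) * hat W t ≤ D ^ 2 * moment W (2 * n + 1) :=
    calc t ^ (n / 2) * hat W t ≤ moment W (n / 2) := hW.pow_mul_hat_le_moment ht _
      _ ≤ D * moment W n := hW.moment_half_le hD n
      _ ≤ D * (D * moment W (2 * n + 1)) := by
        gcongr
        simpa [show (2 * n + 1) / 2 = n by omega] using hW.moment_half_le hD (2 * n + 1)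
      _ = D ^ 2 * moment W (2 * n + 1) := by ring
  have split : n = n / 2 + (n - n / 2) := by omega
  calc (t ^ n * hat W t) ^ 2 = (t ^ (n / 2) * hat W t) ^ 2 * t ^ (2 * (n - n / 2)) := by
        nth_rw 1 [split]
        ring
    _ ≤ (D ^ 2 * moment W (2 * n + 1)) ^ 2 * t ^ n :=
        have := ht.1
        mul_le_mul (pow_le_pow_left₀ (by positivity) half 2)
          (pow_le_pow_of_le_one ht.1 ht.2.le (by omega)) (by positivity) (by positivity)

theorem pow_div_moment_mul_inv_le_tsum (hW : IsRadialWeight W) (ht : t ∈ Ico (0 : ℝ) 1) (m : ℕ) :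
    t ^ m / moment W m * (1 - t)⁻¹ ≤ ∑' n, t ^ n / moment W n := by
  have hs := hW.summable_pow_div_moment ht
  have tail : t ^ m / moment W m * (1 - t)⁻¹ ≤ ∑' n, t ^ (n + m) / moment W (n + m) := by
    refine hasSum_le (fun n => ?_)
      ((hasSum_geometric_of_lt_one ht.1 ht.2).mul_left (t ^ m / moment W m))
      ((summable_nat_add_iff m).2 hs).hasSum
    rw [div_mul_eq_mul_div, ← pow_add, add_comm]
    have := hW.moment_pos (n + m)
    have := ht.1
    gcongr
    exact hW.moment_antitone (by omega)
  rw [← hs.sum_add_tsum_nat_add m]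
  exact le_add_of_nonneg_of_le (Finset.sum_nonneg fun n _ =>
    div_nonneg (pow_nonneg ht.1 n) (hW.moment_pos n).le) tail

theorem inv_le_tsum_pow_div_moment (hW : IsRadialWeight W) {D : ℝ} (hD : DoublingMoments W D)
    (ht : t ∈ Ico (0 : ℝ) 1) :
    ((1 - t) * hat W t)⁻¹ ≤ 8 * D ^ 3 * ∑' n, t ^ n / moment W n := by
  have hD1 := hW.one_le_of_doublingMoments hD
  have hhat := hW.hat_pos ht
  have hsub : 0 < 1 - t := sub_pos.2 ht.2
  obtain ⟨N, hN, hN'⟩ := exists_pow_succ_le_and_le_pow ht.1 ht.2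
    (x := (2 * D)⁻¹) (by positivity) (inv_le_one_of_one_le₀ (by linarith))
  have hmoment : moment W (2 * N) ≤ 2 * D * hat W t :=
    calc moment W (2 * N) ≤ D * moment W (2 * (2 * N) + 2) := hD _
      _ ≤ D * moment W (2 * (N + 1)) := by
        gcongr
        exact hW.moment_antitone (by omega)
      _ ≤ D * (2 * hat W t) := by
        gcongr
        exact hW.moment_two_mul_le_two_mul_hat hD ht hN
      _ = 2 * D * hat W t := by ring
  have hpow : (2 * D)⁻¹ ^ 2 ≤ t ^ (2 * N) := by
    rw [mul_comm 2 N, pow_mul]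
    gcongr
  have := ht.1
  have := hW.moment_pos (2 * N)
  calc ((1 - t) * hat W t)⁻¹
      = 8 * D ^ 3 * ((2 * D)⁻¹ ^ 2 / (2 * D * hat W t) * (1 - t)⁻¹) := by
        field_simp
        norm_num
    _ ≤ 8 * D ^ 3 * (t ^ (2 * N) / moment W (2 * N) * (1 - t)⁻¹) := by gcongr
    _ ≤ 8 * D ^ 3 * ∑' n, t ^ n / moment W n := by
        gcongr
        exact hW.pow_div_moment_mul_inv_le_tsum ht _

theorem rpow_mul_moment_powWeight_le (hW : IsRadialWeight W) {D : ℝ} (hD : DoublingMoments W D)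
    {β : ℝ} (hβ : 0 ≤ β) (n : ℕ) :
    ((n : ℝ) + 1) ^ β * moment (powWeight W β) n
      ≤ 2 ^ β * (β ^ β * Real.exp (1 - β)) * D * moment W n := by
  have := continuous_one_sub_rpow hβ
  calc ((n : ℝ) + 1) ^ β * moment (powWeight W β) n
      = ∫ r in (0 : ℝ)..1, (((n : ℝ) + 1) ^ β * (r ^ n * (1 - r) ^ β)) * W r := by
        rw [moment, ← intervalIntegral.integral_const_mul]
        simp only [powWeight, mul_assoc]
    _ ≤ ∫ r in (0 : ℝ)..1, (2 ^ β * (β ^ β * Real.exp (1 - β)) * r ^ (n / 2)) * W r :=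
        hW.integral_mul_mono (by fun_prop) (by fun_prop) le_rfl zero_le_one le_rfl
          fun r hr => rpow_mul_pow_mul_one_sub_rpow_le_pow_half hβ n hr.1.le hr.2.le
    _ = 2 ^ β * (β ^ β * Real.exp (1 - β)) * moment W (n / 2) := by
        rw [moment, ← intervalIntegral.integral_const_mul]
        simp only [mul_assoc]
    _ ≤ 2 ^ β * (β ^ β * Real.exp (1 - β)) * (D * moment W n) := by
        gcongr
        exact hW.moment_half_le hD n
    _ = 2 ^ β * (β ^ β * Real.exp (1 - β)) * D * moment W n := by ring

theorem moment_sub_moment_le (hW : IsRadialWeight W) (n : ℕ) :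
    moment W n - moment W (n + 2) ≤ 2 * moment (powWeight W 1) n := by
  rw [moment, moment, moment, ← intervalIntegral.integral_sub
    (hW.intervalIntegrable_mul (continuous_pow _) (by simp) (by simp))
    (hW.intervalIntegrable_mul (continuous_pow _) (by simp) (by simp)),
    ← intervalIntegral.integral_const_mul]
  simp only [powWeight, Real.rpow_one, ← sub_mul, ← mul_assoc]
  refine hW.integral_mul_mono (by fun_prop) (by fun_prop) le_rfl zero_le_one le_rfl fun r hr => ?_
  have : 0 ≤ r ^ n * (1 - r) ^ 2 := mul_nonneg (pow_nonneg hr.1.le n) (sq_nonneg _)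
  linear_combination this

theorem exists_mul_moment_sub_le (hW : IsRadialWeight W) {D : ℝ} (hD : DoublingMoments W D) :
    ∃ C : ℝ, 0 < C ∧ ∀ n : ℕ,
      ((n : ℝ) + 1) * (moment W (2 * n + 1) - moment W (2 * n + 3)) ≤ C * moment W (2 * n + 1) := by
  have hD1 := hW.one_le_of_doublingMoments hD
  refine ⟨2 * D, by positivity, fun n => ?_⟩
  have hpow := hW.rpow_mul_moment_powWeight_le hD zero_le_one (2 * n + 1)
  simp only [Real.rpow_one, sub_self, Real.exp_zero, mul_one] at hpow
  have hdiff := hW.moment_sub_moment_le (2 * n + 1)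
  calc ((n : ℝ) + 1) * (moment W (2 * n + 1) - moment W (2 * n + 3))
      ≤ ((n : ℝ) + 1) * (2 * moment (powWeight W 1) (2 * n + 1)) := by gcongr
    _ = ((2 * n + 1 : ℕ) + 1) * moment (powWeight W 1) (2 * n + 1) := by
        push_cast
        ring
    _ ≤ 2 * D * moment W (2 * n + 1) := hpow

end IsRadialWeight

theorem exists_pow_eq_inv_and_le_mul_one_sub {D : ℝ} (hD : 1 ≤ D) (n : ℕ) :
    ∃ t ∈ Ioo (0 : ℝ) 1, t ^ (n + 1) = (2 * D)⁻¹ ∧ 1 / 2 ≤ ((n : ℝ) + 1) * (1 - t) := by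
  have hx0 : 0 < (2 * D)⁻¹ := by positivity
  have hx2 : (2 * D)⁻¹ ≤ 1 / 2 := by
    rw [one_div]
    exact inv_anti₀ two_pos (by linarith)
  refine ⟨(2 * D)⁻¹ ^ (((n + 1 : ℕ) : ℝ)⁻¹), ⟨by positivity,
    Real.rpow_lt_one hx0.le (by linarith) (by positivity)⟩,
    Real.rpow_inv_natCast_pow hx0.le n.succ_ne_zero, ?_⟩
  set t := (2 * D)⁻¹ ^ (((n + 1 : ℕ) : ℝ)⁻¹)
  have bernoulli := one_add_mul_sub_le_pow (a := t) (by linarith [show 0 < t by positivity]) (n + 1)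
  rw [Real.rpow_inv_natCast_pow hx0.le n.succ_ne_zero] at bernoulli
  push_cast at bernoulli
  linarith

namespace IsRadialWeight

variable {W : ℝ → ℝ} {α t : ℝ}

theorem hat_sub_hat (hW : IsRadialWeight W) {s : ℝ} (ht : 0 ≤ t) (hts : t ≤ s) (hs : s ≤ 1) :
    hat W t - hat W s = ∫ r in t..s, W r := by
  have left := hW.intervalIntegrable_mul (g := fun _ => 1) continuous_const ⟨ht, hts.trans hs⟩
    ⟨ht.trans hts, hs⟩
  have right := hW.intervalIntegrable_mul (g := fun _ => 1) (b := 1) continuous_const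
    ⟨ht.trans hts, hs⟩ (by simp)
  simp only [one_mul] at left right
  rw [hat, hat, ← intervalIntegral.integral_add_adjacent_intervals left right,
    add_sub_cancel_right]

theorem rpow_mul_hat_sub_le (hW : IsRadialWeight W) (hα : 0 ≤ α) {s : ℝ} (ht : 0 ≤ t)
    (hts : t ≤ s) (hs : s ≤ 1) :
    (1 - s) ^ α * (hat W t - hat W s) ≤ hat (powWeight W α) t := by
  have hcont := continuous_one_sub_rpow hα
  have outer : 0 ≤ ∫ r in s..1, powWeight W α r :=
    hW.integral_mul_nonneg hcont (ht.trans hts) hs le_rfl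
      fun r hr => Real.rpow_nonneg (sub_nonneg.2 hr.2.le) _
  have inner : IntervalIntegrable (powWeight W α) volume t s :=
    hW.intervalIntegrable_mul hcont ⟨ht, hts.trans hs⟩ ⟨ht.trans hts, hs⟩
  rw [hW.hat_sub_hat ht hts hs, ← intervalIntegral.integral_const_mul, hat,
    ← intervalIntegral.integral_add_adjacent_intervals inner
      (hW.intervalIntegrable_mul hcont ⟨ht.trans hts, hs⟩ (by simp))]
  refine (hW.integral_mul_mono continuous_const hcont ht hts hs fun r hr => ?_).trans
    (le_add_of_nonneg_right outer)
  exact Real.rpow_le_rpow (sub_nonneg.2 hs) (by linarith [hr.2]) hα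

theorem hat_powWeight_le (hW : IsRadialWeight W) (hα : 0 ≤ α) (ht : t ∈ Ico (0 : ℝ) 1) :
    hat (powWeight W α) t ≤ (1 - t) ^ α * hat W t := by
  rw [hat, hat, ← intervalIntegral.integral_const_mul]
  exact hW.integral_mul_mono (continuous_one_sub_rpow hα) continuous_const ht.1 ht.2.le le_rfl
    fun r hr => Real.rpow_le_rpow (sub_nonneg.2 hr.2.le) (by linarith [hr.1]) hα

theorem hat_powWeight_ne_zero (hW : IsRadialWeight W) (hα : 0 ≤ α) (ht : t ∈ Ico (0 : ℝ) 1) :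
    hat (powWeight W α) t ≠ 0 := fun h0 => by
  have hnonneg : 0 ≤ᵐ[volume.restrict (Ioc t 1)] powWeight W α := by
    rw [← restrict_Ioo_eq_restrict_Ioc]
    filter_upwards [ae_restrict_mem measurableSet_Ioo] with r hr
    exact mul_nonneg (Real.rpow_nonneg (sub_nonneg.2 hr.2.le) _)
      (hW.nonneg r ⟨ht.1.trans hr.1.le, hr.2⟩)
  have hzero : powWeight W α =ᵐ[volume.restrict (Ioc t 1)] 0 :=
    (intervalIntegral.integral_eq_zero_iff_of_le_of_nonneg_ae ht.2.le hnonneg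
      (hW.intervalIntegrable_mul (continuous_one_sub_rpow hα) ⟨ht.1, ht.2.le⟩ (by simp))).1 h0
  refine hW.hat_ne_zero t ht ?_
  rw [hat, intervalIntegral.integral_of_le ht.2.le]
  refine integral_eq_zero_of_ae ?_
  rw [← restrict_Ioo_eq_restrict_Ioc] at hzero ⊢
  filter_upwards [hzero, ae_restrict_mem measurableSet_Ioo] with r hr hmem
  exact (mul_eq_zero.1 hr).resolve_left (Real.rpow_pos_of_pos (sub_pos.2 hmem.2) _).ne'

protected theorem powWeight (hW : IsRadialWeight W) (hα : 0 ≤ α) :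
    IsRadialWeight (powWeight W α) where
  nonneg r hr := mul_nonneg (Real.rpow_nonneg (sub_nonneg.2 hr.2.le) _) (hW.nonneg r hr)
  integrable := by
    have hcont : Continuous fun z : Disk => (1 - ‖(z : ℂ)‖) ^ α :=
      (continuous_one_sub_rpow hα).comp (continuous_norm.comp continuous_subtype_val)
    refine hW.integrable.bdd_mul (c := 1) hcont.aestronglyMeasurable (.of_forall fun z => ?_)
    have hz : 0 ≤ 1 - ‖(z : ℂ)‖ := sub_nonneg.2 (mem_ball_zero_iff.1 z.2).le
    rw [Real.norm_of_nonneg (Real.rpow_nonneg hz _)]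
    exact Real.rpow_le_one hz (by linarith [norm_nonneg (z : ℂ)]) hα
  hat_ne_zero _ hr := hW.hat_powWeight_ne_zero hα hr

theorem exists_le_hat_powWeight (hW : IsRadialWeight W) (hl : LowerDoubling W) (hα : 0 ≤ α) :
    ∃ c : ℝ, 0 < c ∧ ∀ t ∈ Ico (0 : ℝ) 1, c * (1 - t) ^ α * hat W t ≤ hat (powWeight W α) t := by
  obtain ⟨K, hK, C, hC, hdouble⟩ := hl
  have hC1 : 0 < 1 - C⁻¹ := sub_pos.2 (inv_lt_one_of_one_lt₀ hC)
  refine ⟨K⁻¹ ^ α * (1 - C⁻¹), by positivity, fun t ht => ?_⟩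
  have hsub : 0 < 1 - t := sub_pos.2 ht.2
  have hts : t ≤ 1 - (1 - t) / K := by linarith [div_le_self hsub.le hK.le]
  have hs1 : 1 - (1 - t) / K ≤ 1 := sub_le_self _ (by positivity)
  have hhat : (1 - C⁻¹) * hat W t ≤ hat W t - hat W (1 - (1 - t) / K) := by
    have : hat W (1 - (1 - t) / K) ≤ C⁻¹ * hat W t :=
      (le_inv_mul_iff₀ (one_pos.trans hC)).2 (hdouble t ht)
    linarith
  calc K⁻¹ ^ α * (1 - C⁻¹) * (1 - t) ^ α * hat W t
      = (1 - (1 - (1 - t) / K)) ^ α * ((1 - C⁻¹) * hat W t) := by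
        rw [sub_sub_cancel, div_eq_inv_mul, Real.mul_rpow (by positivity) hsub.le]
        ring
    _ ≤ (1 - (1 - (1 - t) / K)) ^ α * (hat W t - hat W (1 - (1 - t) / K)) :=
        mul_le_mul_of_nonneg_left hhat (Real.rpow_nonneg (sub_nonneg.2 hs1) _)
    _ ≤ hat (powWeight W α) t := hW.rpow_mul_hat_sub_le hα ht.1 hts hs1

theorem exists_le_rpow_mul_moment_powWeight (hW : IsRadialWeight W) {D : ℝ}
    (hD : DoublingMoments W D) (hl : LowerDoubling W) (hα : 0 ≤ α) :
    ∃ c : ℝ, 0 < c ∧ ∀ n : ℕ,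
      c * moment W n ≤ ((n : ℝ) + 1) ^ α * moment (powWeight W α) n := by
  obtain ⟨c, hc, hle⟩ := hW.exists_le_hat_powWeight hl hα
  have hD1 := hW.one_le_of_doublingMoments hD
  refine ⟨(1 / 2) ^ α * (2 * D)⁻¹ * c * (2 * D)⁻¹, by positivity, fun n => ?_⟩
  obtain ⟨t, ⟨ht0, ht1⟩, htn, hsub⟩ := exists_pow_eq_inv_and_le_mul_one_sub hD1 n
  have htI : t ∈ Ico (0 : ℝ) 1 := ⟨ht0.le, ht1⟩
  have hhat : (2 * D)⁻¹ * moment W n ≤ hat W t := by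
    rw [inv_mul_le_iff₀ (by positivity)]
    calc moment W n ≤ D * moment W (2 * (n + 1)) := hD n
      _ ≤ D * (2 * hat W t) := by
        gcongr
        exact hW.moment_two_mul_le_two_mul_hat hD htI htn.le
      _ = 2 * D * hat W t := by ring
  have hpow : (2 * D)⁻¹ ≤ t ^ n := htn ▸ pow_le_pow_of_le_one ht0.le ht1.le n.le_succ
  have hrpow : (1 / 2) ^ α ≤ ((n : ℝ) + 1) ^ α * (1 - t) ^ α := by
    rw [← Real.mul_rpow (by positivity) (by linarith)]
    exact Real.rpow_le_rpow (by positivity) hsub hα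
  have := (hW.moment_pos n).le
  have := Real.rpow_nonneg (sub_nonneg.2 ht1.le) α
  calc (1 / 2) ^ α * (2 * D)⁻¹ * c * (2 * D)⁻¹ * moment W n
      = (1 / 2) ^ α * (2 * D)⁻¹ * c * ((2 * D)⁻¹ * moment W n) := by ring
    _ ≤ ((n : ℝ) + 1) ^ α * (1 - t) ^ α * t ^ n * c * hat W t :=
        mul_le_mul (mul_le_mul_of_nonneg_right (mul_le_mul hrpow hpow (by positivity)
          (by positivity)) hc.le) hhat (by positivity) (by positivity)
    _ = ((n : ℝ) + 1) ^ α * (t ^ n * (c * (1 - t) ^ α * hat W t)) := by ring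
    _ ≤ ((n : ℝ) + 1) ^ α * (t ^ n * hat (powWeight W α) t) :=
        mul_le_mul_of_nonneg_left (mul_le_mul_of_nonneg_left (hle t htI) (by positivity))
          (by positivity)
    _ ≤ ((n : ℝ) + 1) ^ α * moment (powWeight W α) n :=
        mul_le_mul_of_nonneg_left ((hW.powWeight hα).pow_mul_hat_le_moment htI n) (by positivity)

end IsRadialWeight

namespace IsDoublingWeight

variable {W : ℝ → ℝ} {α : ℝ}

theorem upperDoubling_powWeight (hW : IsDoublingWeight W) (hα : 0 ≤ α) :
    UpperDoubling (powWeight W α) := by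
  obtain ⟨C, hC, hdouble⟩ := hW.upper
  obtain ⟨c, hc, hle⟩ := hW.radialWeight.exists_le_hat_powWeight hW.lower hα
  refine ⟨2 ^ α * C * c⁻¹, by positivity, fun t ht => ?_⟩
  have hs : (1 + t) / 2 ∈ Ico (0 : ℝ) 1 := ⟨by linarith [ht.1], by linarith [ht.2]⟩
  have hsub : 0 ≤ 1 - t := sub_nonneg.2 ht.2.le
  calc hat (powWeight W α) t ≤ (1 - t) ^ α * hat W t :=
        hW.radialWeight.hat_powWeight_le hα ht
    _ ≤ (1 - t) ^ α * (C * hat W ((1 + t) / 2)) :=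
        mul_le_mul_of_nonneg_left (hdouble t ht) (Real.rpow_nonneg hsub _)
    _ = 2 ^ α * C * c⁻¹ * (c * (1 - (1 + t) / 2) ^ α * hat W ((1 + t) / 2)) := by
        rw [show 1 - t = 2 * (1 - (1 + t) / 2) by ring,
          Real.mul_rpow two_pos.le (sub_nonneg.2 hs.2.le)]
        field_simp
    _ ≤ 2 ^ α * C * c⁻¹ * hat (powWeight W α) ((1 + t) / 2) :=
        mul_le_mul_of_nonneg_left (hle _ hs) (by positivity)

theorem exists_multiplier_le (hW : IsDoublingWeight W) (hα : 0 ≤ α) :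
    ∃ C : ℝ, 0 < C ∧ ∀ n : ℕ, multiplier W (powWeight W α) n ≤ C * ((n : ℝ) + 1) ^ α := by
  obtain ⟨D, hD⟩ := hW.radialWeight.exists_doublingMoments hW.upper
  obtain ⟨c, hc, hle⟩ := hW.radialWeight.exists_le_rpow_mul_moment_powWeight hD hW.lower hα
  refine ⟨c⁻¹ * 2 ^ α, by positivity, fun n => ?_⟩
  rw [multiplier, div_le_iff₀ ((hW.radialWeight.powWeight hα).moment_pos _), mul_assoc, mul_assoc,
    le_inv_mul_iff₀ hc, ← mul_assoc, ← Real.mul_rpow two_pos.le (by positivity)]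
  rw [show 2 * ((n : ℝ) + 1) = (2 * n + 1 : ℕ) + 1 by push_cast; ring]
  exact hle (2 * n + 1)

theorem exists_multiplier_succ_le (hW : IsDoublingWeight W) (hα : 0 ≤ α) :
    ∃ C : ℝ, 0 < C ∧
      ∀ n : ℕ, multiplier W (powWeight W α) (n + 1) ≤ C * ((n : ℝ) + 1) ^ α := by
  obtain ⟨B, hB, hle⟩ := hW.exists_multiplier_le hα
  refine ⟨B * 2 ^ α, by positivity, fun n => (hle (n + 1)).trans ?_⟩
  rw [mul_assoc]
  refine mul_le_mul_of_nonneg_left (rpow_le_mul_rpow_of_le_mul hα two_pos.le (by positivity)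
    (by positivity) ?_) hB.le
  push_cast
  linarith [n.cast_nonneg (α := ℝ)]

end IsDoublingWeight

theorem abs_mul_div_sub_mul_div_le {c x y p q C C' : ℝ} (hc : 0 ≤ c) (hy : 0 ≤ y) (hyx : y ≤ x)
    (hq : 0 < q) (hqp : q ≤ p) (hx : c * (x - y) ≤ C * x) (hp : c * (p - q) ≤ C' * p) :
    |(c + 1) * (y / q) - c * (x / p)| ≤ (1 + C') * (y / q) + C * (x / p) := by
  have hp0 : 0 < p := hq.trans_le hqp
  have : 0 ≤ y / q := by positivity
  have : 0 ≤ c * (p - q) / p := div_nonneg (mul_nonneg hc (sub_nonneg.2 hqp)) hp0.le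
  have h₂ : c * (p - q) / p ≤ C' := (div_le_iff₀ hp0).2 hp
  have h₃ : 0 ≤ c * (x - y) / p := div_nonneg (mul_nonneg hc (sub_nonneg.2 hyx)) hp0.le
  have h₄ : c * (x - y) / p ≤ C * (x / p) := by
    rw [mul_div_assoc']
    exact div_le_div_of_nonneg_right hx hp0.le
  have split : (c + 1) * (y / q) - c * (x / p)
      = y / q * (1 + c * (p - q) / p) - c * (x - y) / p := by
    field_simp
    ring
  have h₅ : y / q * (1 + c * (p - q) / p) ≤ y / q * (1 + C') := by gcongr
  have h₆ : 0 ≤ y / q * (1 + c * (p - q) / p) := by positivity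
  rw [split, abs_le]
  constructor <;> linarith

/-- The coefficients of `w ↦ ∑ (n + 1) * kernelCoeff W (n + 1) * w ^ n`, which gives the
`z`-derivative of the conjugated Bergman kernel. -/
def derivKernelCoeff (W : ℝ → ℝ) (n : ℕ) : ℝ := (n + 1) * kernelCoeff W (n + 1)

/-- The coefficients of the kernel that expresses `R^{W,V} h` through `h'`. -/
def fracKernelCoeff (W V : ℝ → ℝ) (n : ℕ) : ℝ := (n + 2) * multiplier W V (n + 1)

theorem firstDiff_derivKernelCoeff (W : ℝ → ℝ) (n : ℕ) :
    firstDiff (fun n => (derivKernelCoeff W n : ℂ)) n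
      = (((n + 1) * kernelCoeff W (n + 1) - n * kernelCoeff W n : ℝ) : ℂ) := by
  cases n <;> simp [firstDiff, derivKernelCoeff]

theorem IsRadialWeight.exists_norm_firstDiff_derivKernelCoeff_le {W : ℝ → ℝ}
    (hW : IsRadialWeight W) {D : ℝ} (hD : DoublingMoments W D) :
    ∃ C : ℝ, 0 < C ∧ ∀ n : ℕ,
      ‖firstDiff (fun n => (derivKernelCoeff W n : ℂ)) n‖ ≤ C / moment W (2 * n + 1) := by
  obtain ⟨C, hC, hsub⟩ := hW.exists_mul_moment_sub_le hD
  have hD1 := hW.one_le_of_doublingMoments hD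
  refine ⟨(1 + C) * (D / 2), by positivity, fun n => ?_⟩
  have hanti : moment W (2 * n + 3) ≤ moment W (2 * n + 1) := hW.moment_antitone (by omega)
  have hpos := hW.moment_pos (2 * n + 3)
  have hpos' := hW.moment_pos (2 * n + 1)
  have hdouble : moment W (2 * n + 1) ≤ D * moment W (2 * n + 3) :=
    (hD _).trans (mul_le_mul_of_nonneg_left (hW.moment_antitone (by omega)) (by positivity))
  have key := abs_mul_div_sub_mul_div_le (x := 1) (y := 1) (C := 0) n.cast_nonneg zero_le_one le_rfl
    (mul_pos two_pos hpos) (mul_le_mul_of_nonneg_left hanti two_pos.le) (by simp)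
    (show (n : ℝ) * (2 * moment W (2 * n + 1) - 2 * moment W (2 * n + 3))
      ≤ C * (2 * moment W (2 * n + 1)) by linarith [hsub n])
  rw [firstDiff_derivKernelCoeff, Complex.norm_real, Real.norm_eq_abs, kernelCoeff, kernelCoeff,
    show 2 * (n + 1) + 1 = 2 * n + 3 by ring]
  refine (by simpa using key : _ ≤ (1 + C) * (2 * moment W (2 * n + 3))⁻¹) |>.trans ?_
  rw [mul_div_assoc]
  gcongr
  rw [div_div, inv_eq_one_div, div_le_div_iff₀ (by positivity) (by positivity)]
  linarith

theorem IsDoublingWeight.exists_norm_firstDiff_fracKernelCoeff_le {W : ℝ → ℝ} {α : ℝ}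
    (hW : IsDoublingWeight W) (hα : 0 ≤ α) :
    ∃ C : ℝ, 0 < C ∧ ∀ n : ℕ,
      ‖firstDiff (fun n => (fracKernelCoeff W (powWeight W α) n : ℂ)) n‖
        ≤ C * ((n : ℝ) + 1) ^ α := by
  have hV := hW.radialWeight.powWeight hα
  obtain ⟨D, hD⟩ := hW.radialWeight.exists_doublingMoments hW.upper
  obtain ⟨D', hD'⟩ := hV.exists_doublingMoments (hW.upperDoubling_powWeight hα)
  obtain ⟨C, hC, hsub⟩ := hW.radialWeight.exists_mul_moment_sub_le hD
  obtain ⟨C', hC', hsub'⟩ := hV.exists_mul_moment_sub_le hD'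
  obtain ⟨B, hB, hle⟩ := hW.exists_multiplier_le hα
  obtain ⟨B', hB', hsucc⟩ := hW.exists_multiplier_succ_le hα
  have hmult : ∀ n, 0 ≤ multiplier W (powWeight W α) n := fun n =>
    (div_pos (hW.radialWeight.moment_pos _) (hV.moment_pos _)).le
  refine ⟨(3 + C') * B' + C * B, by positivity, fun n => ?_⟩
  have hpos₀ : 0 ≤ C * B * ((n : ℝ) + 1) ^ α := by positivity
  have hpos₁ : 0 ≤ B' * ((n : ℝ) + 1) ^ α := by positivity
  have hpos₂ : 0 ≤ C' * (B' * ((n : ℝ) + 1) ^ α) := by positivity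
  rcases n with _ | n
  · have := hmult 1
    have := hsucc 0
    simp only [firstDiff, fracKernelCoeff, Complex.norm_real, Real.norm_eq_abs]
    rw [abs_of_nonneg (by positivity)]
    norm_num at *
    linarith
  · have key := abs_mul_div_sub_mul_div_le (c := ((n + 1 : ℕ) : ℝ) + 1) (by positivity)
      (hW.radialWeight.moment_pos _).le (hW.radialWeight.moment_antitone (by omega))
      (hV.moment_pos _) (hV.moment_antitone (by omega)) (hsub (n + 1)) (hsub' (n + 1))
    have h₁ := mul_le_mul_of_nonneg_left (hsucc (n + 1)) (by positivity : 0 ≤ 1 + C')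
    have h₂ := mul_le_mul_of_nonneg_left (hle (n + 1)) hC.le
    rw [firstDiff, fracKernelCoeff, fracKernelCoeff, ← Complex.ofReal_sub, Complex.norm_real,
      Real.norm_eq_abs]
    refine (le_of_eq_of_le (congrArg abs ?_) key).trans ?_
    · simp only [multiplier, show 2 * (n + 1 + 1) + 1 = 2 * (n + 1) + 3 by ring]
      push_cast
      ring
    · simp only [multiplier, show 2 * (n + 1 + 1) + 1 = 2 * (n + 1) + 3 by ring] at h₁ h₂
      linarith

theorem norm_coe_lt_one (z : Disk) : ‖(z : ℂ)‖ < 1 := mem_ball_zero_iff.1 z.2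

section DiskIntegral

variable {E : Type*} [NormedAddCommGroup E]

theorem integrable_dA_iff {f : ℂ → E} :
    Integrable (fun ξ : Disk => f ξ) dA ↔ IntegrableOn f (Metric.ball 0 1) := by
  rw [integrableOn_iff_comap_subtypeVal Metric.isOpen_ball.measurableSet, dA,
    integrable_smul_measure (by simp [Real.pi_pos]) (by simp)]
  rfl

instance : IsFiniteMeasure dA := by
  have : Integrable (fun _ : Disk => (1 : ℝ)) dA :=
    integrable_dA_iff (f := fun _ => (1 : ℝ)).2 (integrableOn_const (by finiteness))
  simpa [integrable_const_iff] using this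

variable [NormedSpace ℝ E]

theorem integral_dA (f : ℂ → E) :
    ∫ ξ : Disk, f ξ ∂dA = Real.pi⁻¹ • ∫ ξ in Metric.ball (0 : ℂ) 1, f ξ := by
  rw [dA, integral_smul_measure, integral_subtype_comap Metric.isOpen_ball.measurableSet,
    ENNReal.toReal_ofReal (inv_nonneg.2 Real.pi_pos.le)]

theorem integrableOn_comp_polarCoord_symm {f : ℂ → E} (hf : Integrable f) :
    IntegrableOn (fun p : ℝ × ℝ => p.1 • f (Complex.polarCoord.symm p)) polarCoord.target := by
  have on_plane : IntegrableOn (f ∘ Complex.measurableEquivRealProd.symm)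
      (polarCoord.symm '' polarCoord.target) :=
    (Complex.volume_preserving_equiv_real_prod.symm.integrable_comp_of_integrable hf).integrableOn
  rw [integrableOn_image_iff_integrableOn_abs_det_fderiv_smul volume
    polarCoord.open_target.measurableSet
    (fun p _ => (hasFDerivAt_polarCoord_symm p).hasFDerivWithinAt) polarCoord.symm.injOn]
    at on_plane
  refine on_plane.congr_fun (fun p hp => ?_) polarCoord.open_target.measurableSet
  simp only [det_fderivPolarCoordSymm, abs_of_pos (show 0 < p.1 from hp.1), Function.comp_apply]
  rfl

theorem integral_Ioo_polarCoord (f : ℂ → E) (r : ℝ) :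
    ∫ θ in Ioo (-Real.pi) Real.pi, f (Complex.polarCoord.symm (r, θ))
      = (2 * Real.pi) • Real.circleAverage f 0 r := by
  have on_circle : ∀ θ : ℝ, Complex.polarCoord.symm (r, θ) = circleMap 0 r θ := fun θ => by
    simp [circleMap, Complex.exp_mul_I]
  simp only [on_circle]
  rw [← integral_Ioc_eq_integral_Ioo, ← intervalIntegral.integral_of_le
    (by linarith [Real.pi_pos]), Real.circleAverage_eq_integral_add (-Real.pi),
    intervalIntegral.integral_comp_add_right (fun θ => f (circleMap 0 r θ)), smul_smul,
    mul_inv_cancel₀ (by positivity), one_smul]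
  congr 1 <;> ring

theorem circleAverage_indicator_ball [CompleteSpace E] (f : ℂ → E) {r : ℝ} (hr : 0 ≤ r) :
    Real.circleAverage ((Metric.ball 0 1).indicator f) 0 r
      = (Iio (1 : ℝ)).indicator (Real.circleAverage f 0) r := by
  have mem_iff : ∀ ξ ∈ Metric.sphere (0 : ℂ) |r|, ξ ∈ Metric.ball (0 : ℂ) 1 ↔ r < 1 :=
    fun ξ hξ => by
      have : ‖ξ‖ = r := by simpa [abs_of_nonneg hr] using hξ
      rw [mem_ball_zero_iff, this]
  by_cases h : r < 1
  · rw [indicator_of_mem (show r ∈ Iio 1 from h)]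
    exact Real.circleAverage_congr_sphere fun ξ hξ => indicator_of_mem ((mem_iff ξ hξ).2 h) f
  · rw [indicator_of_notMem (show r ∉ Iio 1 from h)]
    exact Real.circleAverage_const_on_circle fun ξ hξ =>
      indicator_of_notMem (fun hmem => h ((mem_iff ξ hξ).1 hmem)) f

theorem integral_dA_eq_circleAverage [CompleteSpace E] {f : ℂ → E}
    (hf : Integrable (fun ξ : Disk => f ξ) dA) :
    ∫ ξ : Disk, f ξ ∂dA = ∫ r in (0 : ℝ)..1, (2 * r) • Real.circleAverage f 0 r := by
  have hball : MeasurableSet (Metric.ball (0 : ℂ) 1) := Metric.isOpen_ball.measurableSet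
  have hpolar := integrableOn_comp_polarCoord_symm
    ((integrable_dA_iff.1 hf).integrable_indicator hball)
  have radial : ∀ r ∈ Ioi (0 : ℝ), ∫ θ in Ioo (-Real.pi) Real.pi,
      r • (Metric.ball 0 1).indicator f (Complex.polarCoord.symm (r, θ))
      = (Iio (1 : ℝ)).indicator (fun r => (2 * Real.pi * r) • Real.circleAverage f 0 r) r := by
    intro r hr
    rw [integral_smul, integral_Ioo_polarCoord, circleAverage_indicator_ball f (le_of_lt hr),
      smul_smul, mul_comm r, indicator_smul_apply]
  rw [integral_dA, ← integral_indicator hball, ← Complex.integral_comp_polarCoord_symm]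
  rw [polarCoord_target, Measure.volume_eq_prod] at hpolar ⊢
  rw [setIntegral_prod _ hpolar, setIntegral_congr_fun measurableSet_Ioi radial,
    setIntegral_indicator measurableSet_Iio, Ioi_inter_Iio,
    intervalIntegral.integral_of_le zero_le_one, integral_Ioc_eq_integral_Ioo, ← integral_smul]
  refine setIntegral_congr_fun measurableSet_Ioo fun r _ => ?_
  simp only [smul_smul]
  congr 1
  field_simp

theorem circleAverage_radial_smul (W : ℝ → ℝ) (f : ℂ → E) {r : ℝ} (hr : 0 ≤ r) :
    Real.circleAverage (fun ξ : ℂ => W ‖ξ‖ • f ξ) 0 r = W r • Real.circleAverage f 0 r := by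
  rw [← Real.circleAverage_fun_smul]
  refine Real.circleAverage_congr_sphere fun ξ hξ => ?_
  have hξr : ‖ξ‖ = r := by simpa [abs_of_nonneg hr] using hξ
  simp only [hξr]

end DiskIntegral

section PowerSeriesOnDisk

variable {a k : ℕ → ℂ} {z : ℂ}

theorem summableOnDisk_mul_pow (ha : SummableOnDisk a) (hz : ‖z‖ ≤ 1) :
    SummableOnDisk fun n => a n * z ^ n := by
  refine ha.of_norm_le (C := 1) fun n => ?_
  rw [norm_mul, norm_pow, one_mul]
  exact mul_le_of_le_one_right (norm_nonneg _) (pow_le_one₀ (norm_nonneg z) hz)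

theorem seriesEval_injective {b : ℕ → ℂ} (ha : SummableOnDisk a) (hb : SummableOnDisk b)
    (h : ∀ z : ℂ, ‖z‖ < 1 → seriesEval a z = seriesEval b z) : a = b := by
  ext n
  have half0 : (0 : ℝ) ≤ 1 / 2 := by norm_num
  have half1 : (1 / 2 : ℝ) < 1 := by norm_num
  have averages : Real.circleAverage (fun ξ => seriesEval a ξ * conj ξ ^ n) 0 (1 / 2)
      = Real.circleAverage (fun ξ => seriesEval b ξ * conj ξ ^ n) 0 (1 / 2) := by
    refine Real.circleAverage_congr_sphere fun ξ hξ => ?_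
    have hξ' : ‖ξ‖ = 1 / 2 := by simpa [abs_of_nonneg half0] using hξ
    simp only [h ξ (by rw [hξ']; exact half1)]
  rw [circleAverage_seriesEval_mul_conj_pow half0 (ha _ half0 half1),
    circleAverage_seriesEval_mul_conj_pow half0 (hb _ half0 half1)] at averages
  exact mul_right_cancel₀ (by simp) averages

theorem differentiableOn_seriesEval (ha : SummableOnDisk a) :
    DifferentiableOn ℂ (seriesEval a) (Metric.ball 0 1) := by
  intro z hz
  obtain ⟨t, hzt, ht1⟩ := exists_between (mem_ball_zero_iff.1 hz)
  have on_ball : DifferentiableOn ℂ (seriesEval a) (Metric.ball 0 t) := by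
    refine Complex.differentiableOn_tsum_of_summable_norm
      (ha t ((norm_nonneg z).trans hzt.le) ht1) (fun n => by fun_prop) Metric.isOpen_ball
      fun n w hw => ?_
    have : ‖w‖ ≤ t := (mem_ball_zero_iff.1 hw).le
    rw [norm_mul, norm_pow]
    gcongr
  exact (on_ball.differentiableAt (Metric.isOpen_ball.mem_nhds
    (mem_ball_zero_iff.2 hzt))).differentiableWithinAt

theorem integral_seriesEval_mul_conj_pow (ha : SummableOnDisk a) {W : ℝ → ℝ} (n : ℕ)
    (hi : Integrable (fun ξ : Disk => seriesEval a ξ * conj (ξ : ℂ) ^ n * (W ‖(ξ : ℂ)‖ : ℂ)) dA) :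
    ∫ ξ : Disk, seriesEval a ξ * conj (ξ : ℂ) ^ n * (W ‖(ξ : ℂ)‖ : ℂ) ∂dA
      = 2 * a n * (moment W (2 * n + 1) : ℂ) := by
  rw [integral_dA_eq_circleAverage
      (f := fun ξ : ℂ => seriesEval a ξ * conj ξ ^ n * (W ‖ξ‖ : ℂ)) hi, moment,
    ← intervalIntegral.integral_ofReal, ← intervalIntegral.integral_const_mul,
    intervalIntegral.integral_of_le zero_le_one, intervalIntegral.integral_of_le zero_le_one,
    integral_Ioc_eq_integral_Ioo, integral_Ioc_eq_integral_Ioo]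
  refine setIntegral_congr_fun measurableSet_Ioo fun r hr => ?_
  simp only [mul_comm _ (W _ : ℂ), ← Complex.real_smul]
  rw [circleAverage_radial_smul W (fun ξ => seriesEval a ξ * conj ξ ^ n) hr.1.le,
    circleAverage_seriesEval_mul_conj_pow hr.1.le (ha r hr.1.le hr.2) n, Complex.real_smul,
    Complex.real_smul]
  push_cast
  ring

theorem norm_mul_conj_le (z : ℂ) (ξ : Disk) : ‖z * conj (ξ : ℂ)‖ ≤ ‖z‖ := by
  rw [norm_mul, RCLike.norm_conj]
  exact mul_le_of_le_one_right (norm_nonneg z) (norm_coe_lt_one ξ).le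

theorem continuous_seriesEval_mul_conj (hk : SummableOnDisk k) (hz : ‖z‖ < 1) :
    Continuous fun ξ : Disk => seriesEval k (z * conj (ξ : ℂ)) :=
  (continuousOn_seriesEval (hk ‖z‖ (norm_nonneg z) hz)).comp_continuous (by fun_prop)
    fun ξ => mem_closedBall_zero_iff.2 (norm_mul_conj_le z ξ)

theorem integrable_mul_seriesEval_mul_conj {φ : Disk → ℂ} (hφ : Integrable φ dA)
    (hk : SummableOnDisk k) (hz : ‖z‖ < 1) :
    Integrable (fun ξ : Disk => φ ξ * seriesEval k (z * conj (ξ : ℂ))) dA :=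
  hφ.mul_bdd (continuous_seriesEval_mul_conj hk hz).aestronglyMeasurable
    (.of_forall fun ξ => norm_seriesEval_le (hk ‖z‖ (norm_nonneg z) hz) (norm_mul_conj_le z ξ))

theorem norm_mul_conj_pow_le {φ : Disk → ℂ} (n : ℕ) (ξ : Disk) :
    ‖φ ξ * conj (ξ : ℂ) ^ n‖ ≤ ‖φ ξ‖ := by
  rw [norm_mul, norm_pow, RCLike.norm_conj]
  exact mul_le_of_le_one_right (norm_nonneg _) (pow_le_one₀ (norm_nonneg _) (norm_coe_lt_one ξ).le)

theorem integrable_mul_conj_pow {φ : Disk → ℂ} (hφ : Integrable φ dA) (n : ℕ) :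
    Integrable (fun ξ : Disk => φ ξ * conj (ξ : ℂ) ^ n) dA :=
  hφ.mono (hφ.1.mul (Continuous.aestronglyMeasurable (by fun_prop)))
    (.of_forall (norm_mul_conj_pow_le n))

theorem hasSum_integral_mul_seriesEval {φ : Disk → ℂ} (hφ : Integrable φ dA)
    (hk : SummableOnDisk k) (hz : ‖z‖ < 1) :
    HasSum (fun n => k n * (∫ ξ : Disk, φ ξ * conj (ξ : ℂ) ^ n ∂dA) * z ^ n)
      (∫ ξ : Disk, φ ξ * seriesEval k (z * conj (ξ : ℂ)) ∂dA) := by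
  have termwise := hasSum_integral_of_summable_integral_norm (μ := dA)
    (F := fun (n : ℕ) (ξ : Disk) => k n * z ^ n * (φ ξ * conj (ξ : ℂ) ^ n))
    (fun n => (integrable_mul_conj_pow hφ n).const_mul _) (by
      refine Summable.of_nonneg_of_le (fun n => integral_nonneg fun ξ => norm_nonneg _)
        (fun n => ?_) ((hk ‖z‖ (norm_nonneg z) hz).mul_right (∫ ξ : Disk, ‖φ ξ‖ ∂dA))
      simp only [norm_mul (k n * z ^ n)]
      rw [integral_const_mul, norm_mul, norm_pow]
      exact mul_le_mul_of_nonneg_left (integral_mono (integrable_mul_conj_pow hφ n).norm hφ.norm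
        (norm_mul_conj_pow_le n)) (by positivity))
  simp only [integral_const_mul] at termwise
  have expand : ∀ ξ : Disk, φ ξ * seriesEval k (z * conj (ξ : ℂ))
      = ∑' n, k n * z ^ n * (φ ξ * conj (ξ : ℂ) ^ n) := fun ξ => by
    rw [seriesEval, ← tsum_mul_left]
    congr! 2 with n
    rw [mul_pow]
    ring
  simp only [expand]
  refine termwise.congr_fun fun n => ?_
  ring

end PowerSeriesOnDisk

section Coefficients

variable {a : ℕ → ℂ}

/-- The Taylor coefficients at the origin of an analytic function on the disk. -/
def coeff (f : Hol) (n : ℕ) : ℂ := (n.factorial : ℂ)⁻¹ * iteratedDeriv n (extend f) 0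

theorem hasSum_coeff (f : Hol) (z : Disk) : HasSum (fun n => coeff f n * (z : ℂ) ^ n) (f z) := by
  have taylor := Complex.hasSum_taylorSeries_on_ball f.2 z.2
  rw [extend_coe] at taylor
  refine taylor.congr_fun fun n => ?_
  simp only [coeff, smul_eq_mul, sub_zero]
  ring

theorem seriesEval_coeff (f : Hol) (z : Disk) : seriesEval (coeff f) z = f z :=
  (hasSum_coeff f z).tsum_eq

theorem summableOnDisk_coeff (f : Hol) : SummableOnDisk (coeff f) := fun t ht0 ht1 => by
  simpa [abs_of_nonneg ht0] using
    (hasSum_coeff f ⟨t, by simpa [abs_of_nonneg ht0] using ht1⟩).summable.norm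

theorem coeff_eq {f : Hol} (ha : SummableOnDisk a) (h : ∀ z : Disk, f z = seriesEval a z) :
    coeff f = a :=
  seriesEval_injective (summableOnDisk_coeff f) ha fun z hz => by
    rw [← h ⟨z, mem_ball_zero_iff.2 hz⟩, ← seriesEval_coeff]

theorem hol_ext {f g : Hol} (h : ∀ z, f z = g z) : f = g := Subtype.ext (ContinuousMap.ext h)

theorem coeff_injective : Function.Injective coeff := fun f g h =>
  hol_ext fun z => by rw [← seriesEval_coeff, h, seriesEval_coeff]

/-- The analytic function on the disk with given Taylor coefficients. -/
def ofSeries (a : ℕ → ℂ) (ha : SummableOnDisk a) : Hol :=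
  ⟨⟨fun z : Disk => seriesEval a z,
    continuousOn_iff_continuous_domRestrict.1 (differentiableOn_seriesEval ha).continuousOn⟩,
    (differentiableOn_seriesEval ha).congr fun z hz => by rw [extend_of_mem _ hz]; rfl⟩

theorem ofSeries_apply (ha : SummableOnDisk a) (z : Disk) :
    ofSeries a ha z = seriesEval a z := rfl

theorem coeff_ofSeries (ha : SummableOnDisk a) : coeff (ofSeries a ha) = a :=
  coeff_eq ha fun _ => rfl

theorem coeff_add (f g : Hol) : coeff (f + g) = coeff f + coeff g := by
  have hs : SummableOnDisk (coeff f + coeff g) := fun t ht0 ht1 => by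
    refine Summable.of_nonneg_of_le (fun n => by positivity) (fun n => ?_)
      ((summableOnDisk_coeff f t ht0 ht1).add (summableOnDisk_coeff g t ht0 ht1))
    rw [← add_mul]
    exact mul_le_mul_of_nonneg_right (norm_add_le _ _) (pow_nonneg ht0 n)
  refine coeff_eq hs fun z => (((hasSum_coeff f z).add (hasSum_coeff g z)).congr_fun
    fun n => ?_).tsum_eq.symm
  rw [Pi.add_apply, add_mul]

theorem coeff_smul (c : ℂ) (f : Hol) : coeff (c • f) = c • coeff f := by
  have hs : SummableOnDisk (c • coeff f) :=
    (summableOnDisk_coeff f).of_norm_le fun n => (norm_mul c _).le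
  refine coeff_eq hs fun z => (((hasSum_coeff f z).mul_left c).congr_fun fun n => ?_).tsum_eq.symm
  rw [Pi.smul_apply, smul_eq_mul, mul_assoc]

theorem coeff_dilate (r : Ioo (0 : ℝ) 1) (f : Hol) (n : ℕ) :
    coeff (dilate r f) n = coeff f n * ((r : ℝ) : ℂ) ^ n := by
  have hr : ‖((r : ℝ) : ℂ)‖ ≤ 1 := by simpa [abs_of_pos r.2.1] using r.2.2.le
  refine congr_fun (coeff_eq (summableOnDisk_mul_pow (summableOnDisk_coeff f) hr) fun z => ?_) n
  refine ((hasSum_coeff f (scale r z)).congr_fun fun k => ?_).tsum_eq.symm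
  rw [scale, mul_pow, mul_assoc]

theorem coeff_zero (f : Hol) : coeff f 0 = f origin := by
  simp [← extend_coe, coeff, origin]

end Coefficients

theorem IsBergmanKernel.apply_eq_conj {W : ℝ → ℝ} {z w : Disk} {K L : Hol}
    (hK : IsBergmanKernel W z K) (hL : IsBergmanKernel W w L) : K w = conj (L z) := by
  rw [hL.2 K hK.1, hK.2 L hL.1, ← integral_conj]
  congr! 2
  simp only [map_mul, Complex.conj_conj, Complex.conj_ofReal]
  ring

namespace IsRadialWeight

variable {W : ℝ → ℝ}

theorem integrable_mul_of_memLp_top (hW : IsRadialWeight W) {φ : Disk → ℂ} (hφ : MemLp φ ∞ dA) :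
    Integrable (fun ξ : Disk => φ ξ * (W ‖(ξ : ℂ)‖ : ℂ)) dA :=
  hW.integrable.ofReal.mul_of_top_right hφ

theorem integrable_mul_of_memA2 (hW : IsRadialWeight W) {f : Hol} (hf : MemA2 W f) :
    Integrable (fun ξ : Disk => f ξ * (W ‖(ξ : ℂ)‖ : ℂ)) dA := by
  refine (hW.integrable.add hf).mono' (f.1.continuous.aestronglyMeasurable.mul
    hW.integrable.ofReal.aestronglyMeasurable) (.of_forall fun ξ => ?_)
  have h := hW.nonneg _ ⟨norm_nonneg _, norm_coe_lt_one ξ⟩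
  rw [norm_mul, Complex.norm_real, Real.norm_of_nonneg h, Pi.add_apply]
  nlinarith [sq_nonneg (‖f ξ‖ - 1 / 2)]

theorem memA2_of_bounded (hW : IsRadialWeight W) {f : Hol} {C : ℝ} (hC : ∀ ξ, ‖f ξ‖ ≤ C) :
    MemA2 W f := by
  refine hW.integrable.bdd_mul (c := C ^ 2)
    (f.1.continuous.norm.pow 2).aestronglyMeasurable (.of_forall fun ξ => ?_)
  rw [norm_pow, norm_norm]
  exact pow_le_pow_left₀ (norm_nonneg _) (hC ξ) 2

theorem kernelCoeff_mul_integral_eq_coeff (hW : IsRadialWeight W) {f : Hol}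
    (hf : Integrable (fun ξ : Disk => f ξ * (W ‖(ξ : ℂ)‖ : ℂ)) dA) (n : ℕ) :
    (kernelCoeff W n : ℂ) * ∫ ξ : Disk, f ξ * (W ‖(ξ : ℂ)‖ : ℂ) * conj (ξ : ℂ) ^ n ∂dA
      = coeff f n := by
  have hi := integrable_mul_conj_pow hf n
  simp only [← seriesEval_coeff f, mul_right_comm _ (W _ : ℂ)] at hi ⊢
  have hne : (moment W (2 * n + 1) : ℂ) ≠ 0 := by exact_mod_cast (hW.moment_pos _).ne'
  rw [integral_seriesEval_mul_conj_pow (summableOnDisk_coeff f) n hi, kernelCoeff]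
  push_cast
  field_simp

theorem summableOnDisk_kernel (hW : IsRadialWeight W) (z : Disk) :
    SummableOnDisk fun n => (kernelCoeff W n : ℂ) * conj (z : ℂ) ^ n :=
  summableOnDisk_mul_pow hW.summableOnDisk_kernelCoeff (by simpa using (norm_coe_lt_one z).le)

theorem conj_ofSeries_kernel (hW : IsRadialWeight W) (z ξ : Disk) :
    conj (ofSeries _ (hW.summableOnDisk_kernel z) ξ)
      = seriesEval (fun n => (kernelCoeff W n : ℂ)) ((z : ℂ) * conj (ξ : ℂ)) := by
  rw [ofSeries_apply, seriesEval, seriesEval, Complex.conj_tsum]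
  congr! 2 with n
  simp only [map_mul, map_pow, Complex.conj_conj, Complex.conj_ofReal]
  ring

theorem isBergmanKernel_ofSeries (hW : IsRadialWeight W) (z : Disk) :
    IsBergmanKernel W z (ofSeries _ (hW.summableOnDisk_kernel z)) := by
  have hk := hW.summableOnDisk_kernelCoeff
  refine ⟨hW.memA2_of_bounded (C := ∑' n, ‖(kernelCoeff W n : ℂ)‖ * ‖(z : ℂ)‖ ^ n) fun ξ => ?_,
    fun f hf => ?_⟩
  · rw [← RCLike.norm_conj, hW.conj_ofSeries_kernel]
    exact norm_seriesEval_le (hk ‖(z : ℂ)‖ (norm_nonneg _) (norm_coe_lt_one z))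
      (norm_mul_conj_le z ξ)
  · have hi := hW.integrable_mul_of_memA2 hf
    have expansion := hasSum_integral_mul_seriesEval hi hk (norm_coe_lt_one z)
    simp only [hW.kernelCoeff_mul_integral_eq_coeff hi] at expansion
    simp only [hW.conj_ofSeries_kernel, mul_right_comm (f _), (hasSum_coeff f z).unique expansion]

theorem bergmanKernel_eq (hW : IsRadialWeight W) (z : Disk) :
    bergmanKernel W z = ofSeries _ (hW.summableOnDisk_kernel z) := by
  have hB : IsBergmanKernel W z (bergmanKernel W z) :=
    Classical.epsilon_spec ⟨_, hW.isBergmanKernel_ofSeries z⟩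
  exact hol_ext fun w => (hB.apply_eq_conj (hW.isBergmanKernel_ofSeries w)).trans
    ((hW.isBergmanKernel_ofSeries z).apply_eq_conj (hW.isBergmanKernel_ofSeries w)).symm

theorem projIntegrand_eq (hW : IsRadialWeight W) (φ : Disk → ℂ) (z : Disk) :
    projIntegrand W φ z = fun ξ : Disk => φ ξ * (W ‖(ξ : ℂ)‖ : ℂ)
      * seriesEval (fun n => (kernelCoeff W n : ℂ)) ((z : ℂ) * conj (ξ : ℂ)) := by
  ext ξ
  rw [projIntegrand, hW.bergmanKernel_eq, hW.conj_ofSeries_kernel, mul_right_comm]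

theorem integrable_projIntegrand (hW : IsRadialWeight W) {φ : Disk → ℂ}
    (hφ : Integrable (fun ξ : Disk => φ ξ * (W ‖(ξ : ℂ)‖ : ℂ)) dA) (z : Disk) :
    Integrable (projIntegrand W φ z) dA := by
  rw [hW.projIntegrand_eq]
  exact integrable_mul_seriesEval_mul_conj hφ hW.summableOnDisk_kernelCoeff (norm_coe_lt_one z)

theorem hasSum_bergmanProj (hW : IsRadialWeight W) {φ : Disk → ℂ}
    (hφ : Integrable (fun ξ : Disk => φ ξ * (W ‖(ξ : ℂ)‖ : ℂ)) dA) (z : Disk) :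
    HasSum (fun n => (kernelCoeff W n : ℂ)
        * (∫ ξ : Disk, φ ξ * (W ‖(ξ : ℂ)‖ : ℂ) * conj (ξ : ℂ) ^ n ∂dA) * (z : ℂ) ^ n)
      (bergmanProj W φ z) := by
  rw [bergmanProj, hW.projIntegrand_eq]
  exact hasSum_integral_mul_seriesEval hφ hW.summableOnDisk_kernelCoeff (norm_coe_lt_one z)

end IsRadialWeight

section Multiplier

variable {a : ℕ → ℂ}

theorem exists_norm_le_of_isCompact {K : Set Disk} (hK : IsCompact K) :
    ∃ ρ ∈ Ico (0 : ℝ) 1, ∀ z ∈ K, ‖(z : ℂ)‖ ≤ ρ := by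
  rcases K.eq_empty_or_nonempty with rfl | hne
  · exact ⟨0, by simp, by simp⟩
  · obtain ⟨z, _, hmax⟩ := hK.exists_isMaxOn hne
      (continuous_norm.comp continuous_subtype_val).continuousOn
    exact ⟨‖(z : ℂ)‖, ⟨norm_nonneg _, norm_coe_lt_one z⟩, fun w hw => hmax hw⟩

theorem isCompact_setOf_norm_le {ρ : ℝ} (hρ : ρ < 1) : IsCompact {z : Disk | ‖(z : ℂ)‖ ≤ ρ} := by
  have hpre : {z : Disk | ‖(z : ℂ)‖ ≤ ρ} = Subtype.val ⁻¹' Metric.closedBall (0 : ℂ) ρ := by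
    ext z
    simp
  rw [hpre, Topology.IsInducing.subtypeVal.isCompact_preimage_iff]
  · exact isCompact_closedBall 0 ρ
  · rw [Subtype.range_val]
    exact Metric.closedBall_subset_ball hρ

theorem hol_tendsto_iff {ι : Type*} {l : Filter ι} {F : ι → Hol} {f : Hol} :
    Filter.Tendsto F l (nhds f) ↔
      ∀ K : Set Disk, IsCompact K → TendstoUniformlyOn (fun i z => F i z) f l K := by
  rw [tendsto_subtype_rng, ContinuousMap.tendsto_iff_forall_isCompact_tendstoUniformlyOn]

theorem norm_coeff_le (f : Hol) {ρ M : ℝ} (hρ0 : 0 < ρ) (hρ1 : ρ < 1)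
    (hM : ∀ z : Disk, ‖(z : ℂ)‖ ≤ ρ → ‖f z‖ ≤ M) (n : ℕ) : ‖coeff f n‖ ≤ M / ρ ^ n := by
  have hsub : Metric.closedBall (0 : ℂ) ρ ⊆ Metric.ball 0 1 := Metric.closedBall_subset_ball hρ1
  have hd : DifferentiableOn ℂ (extend f) (Metric.ball 0 1) := f.2
  have cauchy := Complex.norm_iteratedDeriv_le_of_forall_mem_sphere_norm_le n hρ0
    (hd.diffContOnCl_ball hsub) (C := M) fun z hz => by
      have hz' := Metric.sphere_subset_closedBall hz
      rw [extend_of_mem _ (hsub hz')]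
      exact hM _ (mem_closedBall_zero_iff.1 hz')
  rw [coeff, norm_mul, norm_inv, Complex.norm_natCast,
    inv_mul_le_iff₀ (by exact_mod_cast n.factorial_pos)]
  exact cauchy.trans_eq (mul_div_assoc _ _ _)

/-- The coefficient multiplier `∑ f n z ^ n ↦ ∑ a n f n z ^ n`, as a linear operator. -/
def coeffMulₗ (a : ℕ → ℂ) (ha : SummableOnDisk a) : Hol →ₗ[ℂ] Hol where
  toFun f := ofSeries _ (ha.mul (summableOnDisk_coeff f))
  map_add' f g := coeff_injective (by
    ext n
    simp only [coeff_add, coeff_ofSeries, Pi.add_apply, mul_add])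
  map_smul' c f := coeff_injective (by
    ext n
    simp only [coeff_smul, coeff_ofSeries, RingHom.id_apply, Pi.smul_apply, smul_eq_mul]
    ring)

theorem coeff_coeffMulₗ (ha : SummableOnDisk a) (f : Hol) (n : ℕ) :
    coeff (coeffMulₗ a ha f) n = a n * coeff f n :=
  congr_fun (coeff_ofSeries (ha.mul (summableOnDisk_coeff f))) n

theorem norm_coeffMulₗ_le (ha : SummableOnDisk a) {ρ s M : ℝ} (hρ : 0 ≤ ρ)
    (hρs : ρ < s) (hs : s < 1) {f : Hol} (hM : ∀ z : Disk, ‖(z : ℂ)‖ ≤ s → ‖f z‖ ≤ M)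
    {z : Disk} (hz : ‖(z : ℂ)‖ ≤ ρ) :
    ‖coeffMulₗ a ha f z‖ ≤ (∑' n, ‖a n‖ * (ρ / s) ^ n) * M := by
  have hs0 : 0 < s := hρ.trans_lt hρs
  rw [← (hasSum_coeff (coeffMulₗ a ha f) z).tsum_eq]
  refine tsum_of_norm_bounded
    ((ha (ρ / s) (by positivity) (by rwa [div_lt_one hs0])).hasSum.mul_right M) fun n => ?_
  have cauchy := norm_coeff_le f hs0 hs hM n
  have hquot : 0 ≤ M / s ^ n := (norm_nonneg _).trans cauchy
  rw [coeff_coeffMulₗ, norm_mul, norm_mul, norm_pow]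
  calc ‖a n‖ * ‖coeff f n‖ * ‖(z : ℂ)‖ ^ n ≤ ‖a n‖ * (M / s ^ n) * ρ ^ n := by gcongr
    _ = ‖a n‖ * (ρ / s) ^ n * M := by
        rw [div_pow]
        ring

theorem continuous_coeffMulₗ (ha : SummableOnDisk a) : Continuous (coeffMulₗ a ha) := by
  refine continuous_of_continuousAt_zero (coeffMulₗ a ha) ?_
  rw [ContinuousAt, map_zero, hol_tendsto_iff]
  intro K hK
  obtain ⟨ρ, ⟨hρ0, hρ1⟩, hρ⟩ := exists_norm_le_of_isCompact hK
  obtain ⟨s, hρs, hs⟩ := exists_between hρ1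
  have hid := hol_tendsto_iff.1 (Filter.tendsto_id (x := nhds (0 : Hol))) _
    (isCompact_setOf_norm_le hs)
  rw [Metric.tendstoUniformlyOn_iff] at hid ⊢
  intro ε hε
  set S := ∑' n, ‖a n‖ * (ρ / s) ^ n
  have hS : 0 ≤ S := tsum_nonneg fun n => by
    have := hρ0.trans_lt hρs
    positivity
  filter_upwards [hid (ε / (S + 1)) (by positivity)] with f hf z hz
  have hfs : ∀ w : Disk, ‖(w : ℂ)‖ ≤ s → ‖f w‖ ≤ ε / (S + 1) := fun w hw => by
    simpa using (hf w hw).le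
  calc dist ((0 : Hol) z) (coeffMulₗ a ha f z) = ‖coeffMulₗ a ha f z‖ := by simp
    _ ≤ S * (ε / (S + 1)) := norm_coeffMulₗ_le ha hρ0 hρs hs hfs (hρ z hz)
    _ < ε := by
        rw [mul_div_assoc', div_lt_iff₀ (by positivity)]
        linarith

/-- The coefficient multiplier `∑ f n z ^ n ↦ ∑ a n f n z ^ n`, as a continuous operator. -/
def coeffMul (a : ℕ → ℂ) (ha : SummableOnDisk a) : Hol →L[ℂ] Hol :=
  ⟨coeffMulₗ a ha, continuous_coeffMulₗ ha⟩

theorem coeff_coeffMul (ha : SummableOnDisk a) (f : Hol) (n : ℕ) :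
    coeff (coeffMul a ha f) n = a n * coeff f n := coeff_coeffMulₗ ha f n

end Multiplier

section FracDeriv

theorem summableOnDisk_single (n : ℕ) : SummableOnDisk (Pi.single n 1) :=
  fun t _ _ => summable_of_ne_finset_zero (s := {n}) fun k hk => by simp_all

/-- The function `z ↦ z ^ n` on the disk. -/
def monomial (n : ℕ) : Hol := ofSeries _ (summableOnDisk_single n)

theorem monomial_apply (n : ℕ) (z : Disk) : monomial n z = (z : ℂ) ^ n := by
  rw [monomial, ofSeries_apply, seriesEval, tsum_eq_single n fun k hk => by simp [hk]]
  simp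

theorem hasSum_coeff_smul_monomial (f : Hol) : HasSum (fun n => coeff f n • monomial n) f := by
  rw [HasSum, SummationFilter.unconditional_filter, hol_tendsto_iff]
  intro K hK
  obtain ⟨ρ, ⟨hρ0, hρ1⟩, hρ⟩ := exists_norm_le_of_isCompact hK
  have taylor := tendstoUniformlyOn_tsum (f := fun n (z : Disk) => coeff f n * (z : ℂ) ^ n)
    (summableOnDisk_coeff f ρ hρ0 hρ1) (s := K) fun n z hz => by
      rw [norm_mul, norm_pow]
      have := hρ z hz
      gcongr
  refine (taylor.congr (.of_forall fun s z _ => ?_)).congr_right fun z _ => ?_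
  · simp [monomial_apply]
  · exact (hasSum_coeff f z).tsum_eq

/-- Evaluation at a point of the disk, as a continuous functional on analytic functions. -/
def evalAt (ξ : Disk) : Hol →L[ℂ] ℂ := (ContinuousMap.evalCLM ℂ ξ).comp Hol.subtypeL

theorem hasSum_coeff_mul_map_monomial (R : Hol →L[ℂ] Hol) (f : Hol) (ξ : Disk) :
    HasSum (fun n => coeff f n * R (monomial n) ξ) (R f ξ) := by
  refine (((evalAt ξ).comp R).hasSum (hasSum_coeff_smul_monomial f)).congr_fun fun n => ?_
  rw [map_smul]
  rfl

variable {W V : ℝ → ℝ}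

theorem summableOnDisk_multiplier (hW : IsRadialWeight W) (hV : IsRadialWeight V) :
    SummableOnDisk fun n => (multiplier W V n : ℂ) := by
  refine hV.summableOnDisk_kernelCoeff.of_norm_le (C := 2 * moment W 0) fun n => ?_
  have hWn := hW.moment_pos (2 * n + 1)
  have hVn := hV.moment_pos (2 * n + 1)
  rw [Complex.norm_real, Complex.norm_real, Real.norm_of_nonneg (hV.kernelCoeff_pos n).le,
    multiplier, kernelCoeff, Real.norm_of_nonneg (by positivity), mul_inv, mul_mul_mul_comm,
    mul_inv_cancel₀ two_ne_zero, one_mul, div_eq_mul_inv]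
  gcongr
  exact hW.moment_antitone (Nat.zero_le _)

theorem multiplier_mul_kernelCoeff (hW : IsRadialWeight W) (n : ℕ) :
    (multiplier W V n : ℂ) * kernelCoeff W n = kernelCoeff V n := by
  rw [← Complex.ofReal_mul, multiplier, kernelCoeff, kernelCoeff]
  have := hW.moment_pos (2 * n + 1)
  congr 1
  field_simp

theorem isFracDeriv_coeffMul (hW : IsRadialWeight W) (hV : IsRadialWeight V) :
    IsFracDeriv W V (coeffMul _ (summableOnDisk_multiplier hW hV)) where
  dilate_comm r f := coeff_injective (by
    ext n
    rw [coeff_dilate, coeff_coeffMul, coeff_coeffMul, coeff_dilate, mul_assoc])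
  map_kernel z := coeff_injective (by
    ext n
    rw [coeff_coeffMul, hW.bergmanKernel_eq, hV.bergmanKernel_eq, coeff_ofSeries, coeff_ofSeries,
      ← mul_assoc, multiplier_mul_kernelCoeff hW])

theorem IsFracDeriv.map_monomial (hW : IsRadialWeight W) (hV : IsRadialWeight V)
    {R : Hol →L[ℂ] Hol} (hR : IsFracDeriv W V R) (n : ℕ) (ξ : Disk) :
    R (monomial n) ξ = multiplier W V n * (ξ : ℂ) ^ n := by
  have kernel_expansion : ∀ w : ℂ, ‖w‖ < 1 →
      HasSum (fun n => kernelCoeff W n * R (monomial n) ξ * w ^ n)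
        (seriesEval (fun n => kernelCoeff V n * (ξ : ℂ) ^ n) w) := by
    intro w hw
    have h := hasSum_coeff_mul_map_monomial R (bergmanKernel W ⟨conj w, by simpa using hw⟩) ξ
    rw [hR.map_kernel, hV.bergmanKernel_eq, ofSeries_apply, hW.bergmanKernel_eq,
      coeff_ofSeries] at h
    simpa only [Complex.conj_conj, seriesEval, mul_right_comm] using h
  have hsum : SummableOnDisk fun n => kernelCoeff W n * R (monomial n) ξ := fun t ht0 ht1 => by
    simpa [abs_of_nonneg ht0] using
      (kernel_expansion t (by simpa [abs_of_nonneg ht0] using ht1)).summable.norm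
  have coefficients := congr_fun (seriesEval_injective hsum
    (summableOnDisk_mul_pow hV.summableOnDisk_kernelCoeff (norm_coe_lt_one ξ).le)
    fun w hw => (kernel_expansion w hw).tsum_eq) n
  have hne : (kernelCoeff W n : ℂ) ≠ 0 := by exact_mod_cast (hW.kernelCoeff_pos n).ne'
  refine mul_left_cancel₀ hne ?_
  rw [coefficients, ← multiplier_mul_kernelCoeff hW]
  ring

theorem coeff_fracDeriv (hW : IsRadialWeight W) (hV : IsRadialWeight V) (f : Hol) :
    coeff (fracDeriv W V f) = fun n => multiplier W V n * coeff f n := by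
  have hR : IsFracDeriv W V (fracDeriv W V) :=
    Classical.epsilon_spec ⟨_, isFracDeriv_coeffMul hW hV⟩
  refine coeff_eq ((summableOnDisk_multiplier hW hV).mul (summableOnDisk_coeff f)) fun z =>
    ((hasSum_coeff_mul_map_monomial (fracDeriv W V) f z).congr_fun fun n => ?_).tsum_eq.symm
  rw [hR.map_monomial hW hV]
  ring

end FracDeriv

section KernelIntegral

variable {a : ℕ → ℂ} {z : ℂ}

theorem integrable_norm_seriesEval_mul (ha : SummableOnDisk a) {W : ℝ → ℝ}
    (hW : Integrable (fun ξ : Disk => W ‖(ξ : ℂ)‖) dA) (hz : ‖z‖ < 1) :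
    Integrable (fun ξ : Disk => ‖seriesEval a (z * conj (ξ : ℂ))‖ * W ‖(ξ : ℂ)‖) dA :=
  hW.bdd_mul (continuous_seriesEval_mul_conj ha hz).norm.aestronglyMeasurable
    (.of_forall fun ξ => by
      rw [norm_norm]
      exact norm_seriesEval_le (ha ‖z‖ (norm_nonneg z) hz) (norm_mul_conj_le z ξ))

theorem norm_integral_mul_seriesEval_le (ha : SummableOnDisk a) {W : ℝ → ℝ}
    (hW : Integrable (fun ξ : Disk => W ‖(ξ : ℂ)‖) dA) (hz : ‖z‖ < 1) {φ : Disk → ℂ} {M : ℝ}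
    (hφ : ∀ᵐ ξ : Disk ∂dA, ‖φ ξ‖ ≤ M * W ‖(ξ : ℂ)‖) :
    ‖∫ ξ : Disk, φ ξ * seriesEval a (z * conj (ξ : ℂ)) ∂dA‖
      ≤ M * ∫ ξ : Disk, ‖seriesEval a (z * conj (ξ : ℂ))‖ * W ‖(ξ : ℂ)‖ ∂dA := by
  rw [← integral_const_mul]
  refine norm_integral_le_of_norm_le ((integrable_norm_seriesEval_mul ha hW hz).const_mul M)
    (hφ.mono fun ξ hξ => ?_)
  rw [norm_mul, mul_comm ‖seriesEval _ _‖, ← mul_assoc]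
  exact mul_le_mul_of_nonneg_right hξ (norm_nonneg _)

theorem integral_norm_seriesEval_mul (ha : SummableOnDisk a) {W : ℝ → ℝ}
    (hW : Integrable (fun ξ : Disk => W ‖(ξ : ℂ)‖) dA) (hz : ‖z‖ < 1) :
    ∫ ξ : Disk, ‖seriesEval a (z * conj (ξ : ℂ))‖ * W ‖(ξ : ℂ)‖ ∂dA
      = ∫ r in (0 : ℝ)..1,
        2 * r * (W r * Real.circleAverage (fun ξ => ‖seriesEval a ξ‖) 0 (‖z‖ * r)) := by
  have hi := integrable_norm_seriesEval_mul ha hW hz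
  simp only [mul_comm _ (W _), ← smul_eq_mul (W _)] at hi ⊢
  rw [integral_dA_eq_circleAverage
    (f := fun ξ : ℂ => W ‖ξ‖ • ‖seriesEval a (z * conj ξ)‖) hi]
  refine intervalIntegral.integral_congr fun r hr => ?_
  have hr0 : 0 ≤ r := by
    rw [uIcc_of_le zero_le_one] at hr
    exact hr.1
  simp only [circleAverage_radial_smul W _ hr0]
  rw [circleAverage_comp_mul_conj (fun ξ => ‖seriesEval a ξ‖), smul_eq_mul, smul_eq_mul]

theorem integral_norm_seriesEval_mul_le (ha : SummableOnDisk a) {W : ℝ → ℝ}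
    (hW : Integrable (fun ξ : Disk => W ‖(ξ : ℂ)‖) dA) (hW0 : ∀ r ∈ Ico (0 : ℝ) 1, 0 ≤ W r)
    (hz : ‖z‖ < 1) {A : ℝ → ℝ}
    (hA : ∀ t ∈ Ico (0 : ℝ) 1, Real.circleAverage (fun ξ => ‖seriesEval a ξ‖) 0 t ≤ A t)
    (hint : IntervalIntegrable (fun r => A (‖z‖ * r) * W r) volume 0 1) :
    ∫ ξ : Disk, ‖seriesEval a (z * conj (ξ : ℂ))‖ * W ‖(ξ : ℂ)‖ ∂dA
      ≤ 2 * ∫ r in (0 : ℝ)..1, A (‖z‖ * r) * W r := by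
  have avg_nonneg : ∀ t, 0 ≤ Real.circleAverage (fun ξ => ‖seriesEval a ξ‖) 0 t := fun t =>
    Real.circleAverage_nonneg_of_nonneg fun ξ _ => norm_nonneg _
  rw [integral_norm_seriesEval_mul ha hW hz, ← intervalIntegral.integral_const_mul,
    intervalIntegral.integral_of_le zero_le_one, intervalIntegral.integral_of_le zero_le_one,
    integral_Ioc_eq_integral_Ioo, integral_Ioc_eq_integral_Ioo]
  refine integral_mono_of_nonneg
    (ae_restrict_of_forall_mem measurableSet_Ioo fun r hr => ?_)
    ((intervalIntegrable_iff_integrableOn_Ioo_of_le zero_le_one).1 (hint.const_mul 2))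
    (ae_restrict_of_forall_mem measurableSet_Ioo fun r hr => ?_)
  · have := hr.1.le
    have := hW0 r ⟨hr.1.le, hr.2⟩
    have := avg_nonneg (‖z‖ * r)
    simp only [Pi.zero_apply]
    positivity
  · have hzr : ‖z‖ * r ∈ Ico (0 : ℝ) 1 := ⟨mul_nonneg (norm_nonneg z) hr.1.le,
      mul_lt_one_of_nonneg_of_lt_one_left (norm_nonneg z) hz hr.2.le⟩
    have hWr := hW0 r ⟨hr.1.le, hr.2⟩
    have hWA := mul_le_mul_of_nonneg_left (hA _ hzr) hWr
    have h0 := mul_nonneg hWr (avg_nonneg (‖z‖ * r))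
    calc 2 * r * (W r * Real.circleAverage (fun ξ => ‖seriesEval a ξ‖) 0 (‖z‖ * r))
        ≤ 2 * (W r * Real.circleAverage (fun ξ => ‖seriesEval a ξ‖) 0 (‖z‖ * r)) :=
          mul_le_mul_of_nonneg_right (by linarith [hr.2]) h0
      _ ≤ 2 * (A (‖z‖ * r) * W r) := by linarith

end KernelIntegral

namespace IsRadialWeight

variable {W : ℝ → ℝ} {ρ : ℝ}

theorem summableOnDisk_derivKernelCoeff (hW : IsRadialWeight W) :
    SummableOnDisk fun n => (derivKernelCoeff W n : ℂ) := by
  refine ((summableOnDisk_rpow zero_le_one).mul hW.summableOnDisk_kernelCoeff.shift).of_norm_le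
    (C := 1) fun n => le_of_eq ?_
  simp [derivKernelCoeff]

theorem mul_pow_div_moment_mem_Icc (hW : IsRadialWeight W) (hρ : ρ ∈ Ico (0 : ℝ) 1) (n : ℕ)
    {r : ℝ} (hr : r ∈ Icc (0 : ℝ) 1) :
    (ρ * r) ^ n / moment W n ∈ Icc 0 (ρ ^ n / moment W n) := by
  have hm := (hW.moment_pos n).le
  have hρr := mul_nonneg hρ.1 hr.1
  exact ⟨by positivity, div_le_div_of_nonneg_right
    (pow_le_pow_left₀ hρr (mul_le_of_le_one_right hρ.1 hr.2) n) hm⟩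

theorem intervalIntegrable_tsum_pow_div_moment_mul (hW : IsRadialWeight W)
    (hρ : ρ ∈ Ico (0 : ℝ) 1) :
    IntervalIntegrable (fun r => (∑' n, (ρ * r) ^ n / moment W n) * W r) volume 0 1 := by
  refine hW.intervalIntegrable.continuousOn_mul ?_
  rw [uIcc_of_le zero_le_one]
  refine continuousOn_tsum (fun n => by fun_prop) (hW.summable_pow_div_moment hρ) fun n r hr => ?_
  obtain ⟨h0, h1⟩ := hW.mul_pow_div_moment_mem_Icc hρ n hr
  rwa [Real.norm_of_nonneg h0]

theorem integral_tsum_pow_div_moment_mul (hW : IsRadialWeight W) (hρ : ρ ∈ Ico (0 : ℝ) 1) :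
    ∫ r in (0 : ℝ)..1, (∑' n, (ρ * r) ^ n / moment W n) * W r = (1 - ρ)⁻¹ := by
  have hs := hW.summable_pow_div_moment hρ
  have termwise : ∀ n, ∫ r in (0 : ℝ)..1, (ρ * r) ^ n / moment W n * W r = ρ ^ n := fun n => by
    have : ∀ r : ℝ, (ρ * r) ^ n / moment W n * W r = ρ ^ n / moment W n * (r ^ n * W r) :=
      fun r => by ring
    simp only [this, intervalIntegral.integral_const_mul]
    exact div_mul_cancel₀ _ (hW.moment_pos n).ne'
  have mem_Icc : ∀ᵐ r : ℝ, r ∈ uIoc (0 : ℝ) 1 → r ∈ Icc (0 : ℝ) 1 := .of_forall fun r hr => by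
    rw [uIoc_of_le zero_le_one] at hr
    exact Ioc_subset_Icc_self hr
  have interchange := intervalIntegral.hasSum_integral_of_dominated_convergence (a := 0) (b := 1)
    (μ := volume) (F := fun n r => (ρ * r) ^ n / moment W n * W r)
    (f := fun r => (∑' n, (ρ * r) ^ n / moment W n) * W r)
    (fun n r => ρ ^ n / moment W n * |W r|)
    (fun n => (hW.intervalIntegrable.continuousOn_mul
      (by fun_prop)).def'.aestronglyMeasurable)
    (fun n => mem_Icc.mono fun r hr hr' => ?_)
    (.of_forall fun r _ => hs.mul_right _) ?_ (mem_Icc.mono fun r hr hr' => ?_)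
  · simp only [termwise] at interchange
    exact interchange.unique (hasSum_geometric_of_lt_one hρ.1 hρ.2)
  · obtain ⟨h0, h1⟩ := hW.mul_pow_div_moment_mem_Icc hρ n (hr hr')
    rw [norm_mul, Real.norm_eq_abs (W r), Real.norm_of_nonneg h0]
    exact mul_le_mul_of_nonneg_right h1 (abs_nonneg _)
  · simp only [tsum_mul_right]
    exact hW.intervalIntegrable.abs.const_mul _
  · have hterm := fun n => hW.mul_pow_div_moment_mem_Icc hρ n (hr hr')
    have hsr := Summable.of_nonneg_of_le (fun n => (hterm n).1) (fun n => (hterm n).2) hs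
    exact hsr.hasSum.mul_right _

theorem exists_circleAverage_norm_derivKernel_le (hW : IsRadialWeight W) {D : ℝ}
    (hD : DoublingMoments W D) :
    ∃ C : ℝ, 0 < C ∧ ∀ t ∈ Ico (0 : ℝ) 1,
      Real.circleAverage (fun ξ => ‖seriesEval (fun n => (derivKernelCoeff W n : ℂ)) ξ‖) 0 t
        ≤ C * ∑' n, t ^ n / moment W n := by
  obtain ⟨C, hC, hdiff⟩ := hW.exists_norm_firstDiff_derivKernelCoeff_le hD
  have hD1 := hW.one_le_of_doublingMoments hD
  refine ⟨C * D ^ 2 * (8 * D ^ 3), by positivity, fun t ht => ?_⟩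
  have hhat := hW.hat_pos ht
  have ht0 := ht.1
  have diff_sq_le : ∀ n, (‖firstDiff (fun n => (derivKernelCoeff W n : ℂ)) n‖ * t ^ n) ^ 2
      ≤ (C * D ^ 2 / hat W t) ^ 2 * t ^ n := fun n => by
    have hm := hW.moment_pos (2 * n + 1)
    calc _ ≤ (C / moment W (2 * n + 1) * t ^ n) ^ 2 := by
          gcongr
          exact hdiff n
      _ = (C / (moment W (2 * n + 1) * hat W t)) ^ 2 * (t ^ n * hat W t) ^ 2 := by field_simp
      _ ≤ (C / (moment W (2 * n + 1) * hat W t)) ^ 2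
          * ((D ^ 2 * moment W (2 * n + 1)) ^ 2 * t ^ n) := by
          gcongr
          exact hW.sq_pow_mul_hat_le hD ht n
      _ = (C * D ^ 2 / hat W t) ^ 2 * t ^ n := by field_simp
  calc _ ≤ C * D ^ 2 / hat W t / (1 - t) :=
        circleAverage_norm_seriesEval_le ht0 ht.2 (by positivity)
          (hW.summableOnDisk_derivKernelCoeff t ht0 ht.2) diff_sq_le
    _ = C * D ^ 2 * ((1 - t) * hat W t)⁻¹ := by
        rw [div_div, div_eq_mul_inv, mul_comm (hat W t)]
    _ ≤ C * D ^ 2 * (8 * D ^ 3 * ∑' n, t ^ n / moment W n) :=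
        mul_le_mul_of_nonneg_left (hW.inv_le_tsum_pow_div_moment hD ht) (by positivity)
    _ = C * D ^ 2 * (8 * D ^ 3) * ∑' n, t ^ n / moment W n := (mul_assoc _ _ _).symm

theorem exists_integral_norm_derivKernel_le (hW : IsRadialWeight W) {D : ℝ}
    (hD : DoublingMoments W D) :
    ∃ C : ℝ, 0 < C ∧ ∀ z : ℂ, ‖z‖ < 1 →
      ∫ ξ : Disk, ‖seriesEval (fun n => (derivKernelCoeff W n : ℂ)) (z * conj (ξ : ℂ))‖
        * W ‖(ξ : ℂ)‖ ∂dA ≤ C / (1 - ‖z‖) := by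
  obtain ⟨C, hC, hmean⟩ := hW.exists_circleAverage_norm_derivKernel_le hD
  refine ⟨2 * C, by positivity, fun z hz => ?_⟩
  have hz' : ‖z‖ ∈ Ico (0 : ℝ) 1 := ⟨norm_nonneg z, hz⟩
  refine (integral_norm_seriesEval_mul_le hW.summableOnDisk_derivKernelCoeff hW.integrable
    hW.nonneg hz hmean ?_).trans_eq ?_
  · simpa only [mul_assoc] using (hW.intervalIntegrable_tsum_pow_div_moment_mul hz').const_mul C
  · simp only [mul_assoc C, intervalIntegral.integral_const_mul,
      hW.integral_tsum_pow_div_moment_mul hz']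
    rw [div_eq_mul_inv, mul_assoc]

end IsRadialWeight

section FracKernel

variable {α : ℝ}

theorem summableOnDisk_fracKernelCoeff {W V : ℝ → ℝ} (hW : IsRadialWeight W)
    (hV : IsRadialWeight V) : SummableOnDisk fun n => (fracKernelCoeff W V n : ℂ) := by
  refine ((summableOnDisk_rpow zero_le_one).mul (summableOnDisk_multiplier hW hV).shift).of_norm_le
    (C := 2) fun n => ?_
  rw [fracKernelCoeff, Complex.ofReal_mul, norm_mul, norm_mul, ← mul_assoc, Real.rpow_one,
    Complex.norm_of_nonneg (show (0 : ℝ) ≤ n + 2 by positivity),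
    Complex.norm_of_nonneg (show (0 : ℝ) ≤ n + 1 by positivity)]
  exact mul_le_mul_of_nonneg_right (by linarith [n.cast_nonneg (α := ℝ)]) (norm_nonneg _)

theorem continuousOn_one_sub_mul_rpow (p : ℝ) {ρ : ℝ} (hρ : ρ ∈ Ico (0 : ℝ) 1) :
    ContinuousOn (fun r : ℝ => (1 - ρ * r) ^ p) (uIcc 0 1) := by
  rw [uIcc_of_le zero_le_one]
  refine ContinuousOn.rpow_const (by fun_prop) fun r hr => Or.inl ?_
  nlinarith [hρ.1, hρ.2, hr.1, hr.2]

theorem integral_one_sub_mul_rpow_le (hα : 0 < α) {ρ : ℝ} (hρ : ρ ∈ Ico (0 : ℝ) 1) :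
    ∫ r in (0 : ℝ)..1, (1 - ρ * r) ^ (-α - 1) ≤ (1 + α⁻¹) * (1 - ρ) ^ (-α) := by
  have hpos : ∀ r ∈ uIcc (0 : ℝ) 1, ρ * r ∈ Ico (0 : ℝ) 1 := fun r hr => by
    rw [uIcc_of_le zero_le_one] at hr
    exact ⟨mul_nonneg hρ.1 hr.1, mul_lt_one_of_nonneg_of_lt_one_left hρ.1 hρ.2 hr.2⟩
  set F' : ℝ → ℝ := fun r => (1 + (α - 1) * (ρ * r)) * (1 - ρ * r) ^ (-α - 1)
  have hderiv : ∀ r ∈ uIcc (0 : ℝ) 1,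
      HasDerivAt (fun r : ℝ => r * (1 - ρ * r) ^ (-α)) (F' r) r := fun r hr => by
    have hsub : 0 < 1 - ρ * r := sub_pos.2 (hpos r hr).2
    have hinner : HasDerivAt (fun r : ℝ => 1 - ρ * r) (-ρ) r := by
      simpa using ((hasDerivAt_id r).const_mul ρ).const_sub 1
    refine ((hasDerivAt_id r).mul (hinner.rpow_const (p := -α) (Or.inl hsub.ne'))).congr_deriv ?_
    have hpow : (1 - ρ * r) ^ (-α) = (1 - ρ * r) ^ (-α - 1) * (1 - ρ * r) := by
      rw [← Real.rpow_add_one hsub.ne', sub_add_cancel]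
    simp only [F', id, hpow]
    ring
  have hcont := continuousOn_one_sub_mul_rpow (-α - 1) hρ
  have hF' : IntervalIntegrable F' volume 0 1 :=
    (ContinuousOn.mul (by fun_prop) hcont).intervalIntegrable
  calc ∫ r in (0 : ℝ)..1, (1 - ρ * r) ^ (-α - 1) ≤ ∫ r in (0 : ℝ)..1, (1 + α⁻¹) * F' r := by
        refine intervalIntegral.integral_mono_on zero_le_one hcont.intervalIntegrable
          (hF'.const_mul _) fun r hr => ?_
        obtain ⟨h0, h1⟩ := hpos r (by rwa [uIcc_of_le zero_le_one])
        rw [← mul_assoc]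
        refine le_mul_of_one_le_left (Real.rpow_nonneg (sub_nonneg.2 h1.le) _) ?_
        have : (1 + α⁻¹) * (1 + (α - 1) * (ρ * r)) = 1 + α * (ρ * r) + α⁻¹ * (1 - ρ * r) := by
          field_simp
          ring
        have : 0 ≤ α⁻¹ * (1 - ρ * r) := mul_nonneg (inv_pos.2 hα).le (sub_nonneg.2 h1.le)
        have := mul_nonneg hα.le h0
        linarith
    _ = (1 + α⁻¹) * (1 - ρ) ^ (-α) := by
        rw [intervalIntegral.integral_const_mul,
          intervalIntegral.integral_eq_sub_of_hasDerivAt hderiv hF']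
        simp

theorem circleAverage_norm_seriesEval_le_rpow {a : ℕ → ℂ} (ha : SummableOnDisk a) (hα : 0 < α)
    {C : ℝ} (hC : 0 < C) (hdiff : ∀ n : ℕ, ‖firstDiff a n‖ ≤ C * ((n : ℝ) + 1) ^ α) {t : ℝ}
    (ht : t ∈ Ico (0 : ℝ) 1) :
    Real.circleAverage (fun ξ => ‖seriesEval a ξ‖) 0 t
      ≤ C * √((2 * α) ^ (2 * α) * Real.exp (1 - 2 * α)) * (1 - t) ^ (-α - 1) := by
  have ht0 := ht.1
  have hsub : 0 < 1 - t := sub_pos.2 ht.2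
  set E := (2 * α) ^ (2 * α) * Real.exp (1 - 2 * α)
  have hE : 0 < E := by positivity
  have hsq : ∀ x : ℝ, 0 ≤ x → (x ^ α) ^ 2 = x ^ (2 * α) := fun x hx => by
    rw [← Real.rpow_natCast, ← Real.rpow_mul hx, Nat.cast_ofNat, mul_comm α]
  have diff_sq_le : ∀ n : ℕ, (‖firstDiff a n‖ * t ^ n) ^ 2
      ≤ (C * √E * (1 - t) ^ (-α)) ^ 2 * t ^ n := fun n => by
    have hEn := rpow_mul_pow_mul_one_sub_rpow_le (mul_pos two_pos hα).le n ht0 ht.2.le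
    calc _ ≤ (C * ((n : ℝ) + 1) ^ α * t ^ n) ^ 2 := by
          gcongr
          exact hdiff n
      _ = C ^ 2 * (((n : ℝ) + 1) ^ (2 * α) * (t ^ n * (1 - t) ^ (2 * α)))
          * ((1 - t) ^ (-α)) ^ 2 * t ^ n := by
          rw [← hsq _ (by positivity), ← hsq _ hsub.le, Real.rpow_neg hsub.le]
          field_simp
      _ ≤ C ^ 2 * E * ((1 - t) ^ (-α)) ^ 2 * t ^ n := by gcongr
      _ = (C * √E * (1 - t) ^ (-α)) ^ 2 * t ^ n := by rw [mul_pow, mul_pow, Real.sq_sqrt hE.le]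
  refine (circleAverage_norm_seriesEval_le ht0 ht.2 (by positivity) (ha t ht0 ht.2)
    diff_sq_le).trans_eq ?_
  rw [Real.rpow_sub_one hsub.ne', mul_div_assoc]

theorem IsDoublingWeight.exists_integral_norm_fracKernel_le {W : ℝ → ℝ}
    (hW : IsDoublingWeight W) (hα : 0 < α) :
    ∃ C : ℝ, 0 < C ∧ ∀ z : ℂ, ‖z‖ < 1 →
      ∫ ξ : Disk, ‖seriesEval (fun n => (fracKernelCoeff W (powWeight W α) n : ℂ))
        (z * conj (ξ : ℂ))‖ ∂dA ≤ C * (1 - ‖z‖) ^ (-α) := by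
  have ha := summableOnDisk_fracKernelCoeff hW.radialWeight (hW.radialWeight.powWeight hα.le)
  obtain ⟨C, hC, hdiff⟩ := hW.exists_norm_firstDiff_fracKernelCoeff_le hα.le
  obtain ⟨B, hB, hmean⟩ : ∃ B > 0, ∀ t ∈ Ico (0 : ℝ) 1, Real.circleAverage
      (fun ξ => ‖seriesEval (fun n => (fracKernelCoeff W (powWeight W α) n : ℂ)) ξ‖) 0 t
        ≤ B * (1 - t) ^ (-α - 1) :=
    ⟨_, by positivity, fun t ht => circleAverage_norm_seriesEval_le_rpow ha hα hC hdiff ht⟩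
  refine ⟨2 * (B * (1 + α⁻¹)), by positivity, fun z hz => ?_⟩
  have hz' : ‖z‖ ∈ Ico (0 : ℝ) 1 := ⟨norm_nonneg z, hz⟩
  have polar := integral_norm_seriesEval_mul_le ha (W := fun _ => 1) (integrable_const 1)
    (fun _ _ => zero_le_one) hz hmean (by
      simpa only [mul_one] using
        (continuousOn_one_sub_mul_rpow (-α - 1) hz').intervalIntegrable.const_mul B)
  simp only [mul_one, intervalIntegral.integral_const_mul] at polar
  calc _ ≤ 2 * (B * ∫ r in (0 : ℝ)..1, (1 - ‖z‖ * r) ^ (-α - 1)) := polar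
    _ ≤ 2 * (B * ((1 + α⁻¹) * (1 - ‖z‖) ^ (-α))) := by
        gcongr
        exact integral_one_sub_mul_rpow_le hα hz'
    _ = 2 * (B * (1 + α⁻¹)) * (1 - ‖z‖) ^ (-α) := by ring

end FracKernel

section Derivative

theorem differentiableOn_deriv_extend (f : Hol) :
    DifferentiableOn ℂ (deriv (extend f)) (Metric.ball 0 1) :=
  DifferentiableOn.deriv f.2 Metric.isOpen_ball

theorem continuous_derivative (f : Hol) : Continuous (derivative f) :=
  continuousOn_iff_continuous_domRestrict.1 (differentiableOn_deriv_extend f).continuousOn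

theorem hasSum_derivative (f : Hol) (z : Disk) :
    HasSum (fun n : ℕ => ((n : ℂ) + 1) * coeff f (n + 1) * (z : ℂ) ^ n) (derivative f z) := by
  refine (Complex.hasSum_taylorSeries_on_ball (differentiableOn_deriv_extend f) z.2).congr_fun
    fun n => ?_
  have hn : (n : ℂ) + 1 ≠ 0 := n.cast_add_one_ne_zero
  rw [coeff, iteratedDeriv_succ', Nat.factorial_succ]
  push_cast
  simp only [smul_eq_mul, sub_zero]
  field_simp

theorem summableOnDisk_derivative (f : Hol) :
    SummableOnDisk fun n => ((n : ℂ) + 1) * coeff f (n + 1) := fun t ht0 ht1 => by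
  simpa [abs_of_nonneg ht0] using
    (hasSum_derivative f ⟨t, by simpa [abs_of_nonneg ht0] using ht1⟩).summable.norm

theorem seriesEval_derivative (f : Hol) (z : Disk) :
    seriesEval (fun n => ((n : ℂ) + 1) * coeff f (n + 1)) z = derivative f z :=
  (hasSum_derivative f z).tsum_eq

end Derivative

section Projection

variable {W : ℝ → ℝ}

theorem ae_norm_le (Φ : Lp ℂ ∞ dA) : ∀ᵐ ξ ∂dA, ‖Φ ξ‖ ≤ ‖Φ‖ := by
  filter_upwards [ae_le_eLpNormEssSup (f := Φ)] with ξ hξ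
  rw [Lp.norm_def, eLpNorm_exponent_top, ← toReal_enorm]
  exact ENNReal.toReal_mono (eLpNorm_exponent_top (f := Φ) ▸ (Lp.memLp Φ).eLpNorm_ne_top) hξ

theorem IsRadialWeight.integrable_Lp_mul (hW : IsRadialWeight W) (Φ : Lp ℂ ∞ dA) :
    Integrable (fun ξ : Disk => Φ ξ * (W ‖(ξ : ℂ)‖ : ℂ)) dA :=
  hW.integrable_mul_of_memLp_top (Lp.memLp Φ)

theorem IsRadialWeight.ae_norm_Lp_mul_le (hW : IsRadialWeight W) (Φ : Lp ℂ ∞ dA) :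
    ∀ᵐ ξ : Disk ∂dA, ‖Φ ξ * (W ‖(ξ : ℂ)‖ : ℂ)‖ ≤ ‖Φ‖ * W ‖(ξ : ℂ)‖ :=
  (ae_norm_le Φ).mono fun ξ hξ => by
    have hWξ := hW.nonneg _ ⟨norm_nonneg _, norm_coe_lt_one ξ⟩
    rw [norm_mul, Complex.norm_real, Real.norm_of_nonneg hWξ]
    exact mul_le_mul_of_nonneg_right hξ hWξ

theorem IsRadialWeight.summableOnDisk_kernelCoeff_mul_integral (hW : IsRadialWeight W)
    {φ : Disk → ℂ} (hφ : Integrable φ dA) :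
    SummableOnDisk fun n => kernelCoeff W n * ∫ ξ : Disk, φ ξ * conj (ξ : ℂ) ^ n ∂dA := by
  refine hW.summableOnDisk_kernelCoeff.of_norm_le (C := ∫ ξ : Disk, ‖φ ξ‖ ∂dA) fun n => ?_
  rw [norm_mul, mul_comm]
  exact mul_le_mul_of_nonneg_right (norm_integral_le_of_norm_le hφ.norm
    (.of_forall (norm_mul_conj_pow_le n))) (norm_nonneg _)

/-- The Bergman projection as a linear map from `L^∞` to the analytic functions, defined by the
Taylor coefficients of its values; `projLinearMap_apply` identifies it with `bergmanProj`. -/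
def projLinearMap (hW : IsRadialWeight W) : Lp ℂ ∞ dA →ₗ[ℂ] Hol where
  toFun Φ := ofSeries _ (hW.summableOnDisk_kernelCoeff_mul_integral (hW.integrable_Lp_mul Φ))
  map_add' Φ Ψ := coeff_injective (by
    ext n
    simp only [coeff_add, coeff_ofSeries, Pi.add_apply]
    rw [← mul_add, ← integral_add (integrable_mul_conj_pow (hW.integrable_Lp_mul Φ) n)
      (integrable_mul_conj_pow (hW.integrable_Lp_mul Ψ) n)]
    congr 1
    refine integral_congr_ae ((Lp.coeFn_add Φ Ψ).mono fun ξ hξ => ?_)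
    simp only [hξ, Pi.add_apply, add_mul])
  map_smul' c Φ := coeff_injective (by
    ext n
    simp only [coeff_smul, coeff_ofSeries, RingHom.id_apply, Pi.smul_apply, smul_eq_mul]
    rw [mul_left_comm, ← integral_const_mul c]
    congr 1
    refine integral_congr_ae ((Lp.coeFn_smul c Φ).mono fun ξ hξ => ?_)
    simp only [hξ, Pi.smul_apply, smul_eq_mul, mul_assoc])

theorem coeff_projLinearMap (hW : IsRadialWeight W) (Φ : Lp ℂ ∞ dA) (n : ℕ) :
    coeff (projLinearMap hW Φ) n
      = kernelCoeff W n * ∫ ξ : Disk, Φ ξ * (W ‖(ξ : ℂ)‖ : ℂ) * conj (ξ : ℂ) ^ n ∂dA :=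
  congr_fun (coeff_ofSeries
    (hW.summableOnDisk_kernelCoeff_mul_integral (hW.integrable_Lp_mul Φ))) n

theorem projLinearMap_apply (hW : IsRadialWeight W) (Φ : Lp ℂ ∞ dA) (z : Disk) :
    projLinearMap hW Φ z = bergmanProj W Φ z :=
  (hW.hasSum_bergmanProj (hW.integrable_Lp_mul Φ) z).tsum_eq

theorem derivative_projLinearMap (hW : IsRadialWeight W) (Φ : Lp ℂ ∞ dA) (z : Disk) :
    derivative (projLinearMap hW Φ) z = ∫ ξ : Disk, Φ ξ * (W ‖(ξ : ℂ)‖ : ℂ) * conj (ξ : ℂ) ^ 1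
      * seriesEval (fun n => (derivKernelCoeff W n : ℂ)) ((z : ℂ) * conj (ξ : ℂ)) ∂dA := by
  refine (hasSum_derivative _ z).unique ((hasSum_integral_mul_seriesEval
    (integrable_mul_conj_pow (hW.integrable_Lp_mul Φ) 1) hW.summableOnDisk_derivKernelCoeff
    (norm_coe_lt_one z)).congr_fun fun n => ?_)
  simp only [coeff_projLinearMap, mul_assoc, ← pow_add, add_comm 1 n, derivKernelCoeff]
  push_cast
  ring

theorem norm_derivative_projLinearMap_le (hW : IsRadialWeight W) (Φ : Lp ℂ ∞ dA) (z : Disk) :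
    ‖derivative (projLinearMap hW Φ) z‖ ≤ ‖Φ‖ * ∫ ξ : Disk,
      ‖seriesEval (fun n => (derivKernelCoeff W n : ℂ)) ((z : ℂ) * conj (ξ : ℂ))‖
        * W ‖(ξ : ℂ)‖ ∂dA := by
  rw [derivative_projLinearMap]
  exact norm_integral_mul_seriesEval_le hW.summableOnDisk_derivKernelCoeff hW.integrable
    (norm_coe_lt_one z) ((hW.ae_norm_Lp_mul_le Φ).mono fun ξ hξ =>
      (norm_mul_conj_pow_le (φ := fun ξ : Disk => Φ ξ * (W ‖(ξ : ℂ)‖ : ℂ)) 1 ξ).trans hξ)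

theorem norm_projLinearMap_origin_le (hW : IsRadialWeight W) (Φ : Lp ℂ ∞ dA) :
    ‖projLinearMap hW Φ origin‖
      ≤ kernelCoeff W 0 * (∫ ξ : Disk, W ‖(ξ : ℂ)‖ ∂dA) * ‖Φ‖ := by
  have integral_le : ‖∫ ξ : Disk, Φ ξ * (W ‖(ξ : ℂ)‖ : ℂ) ∂dA‖
      ≤ (∫ ξ : Disk, W ‖(ξ : ℂ)‖ ∂dA) * ‖Φ‖ := by
    rw [mul_comm, ← integral_const_mul]
    exact norm_integral_le_of_norm_le (hW.integrable.const_mul _) (hW.ae_norm_Lp_mul_le Φ)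
  have hk := (hW.kernelCoeff_pos 0).le
  simp only [← coeff_zero, coeff_projLinearMap, pow_zero, mul_one]
  rw [norm_mul, Complex.norm_real, Real.norm_of_nonneg hk, mul_assoc]
  exact mul_le_mul_of_nonneg_left integral_le hk

theorem exists_blochNorm_projLinearMap_le (hW : IsRadialWeight W) {D : ℝ}
    (hD : DoublingMoments W D) :
    ∃ C : ℝ, ∀ Φ : Lp ℂ ∞ dA, MemBloch (projLinearMap hW Φ) ∧
      blochNorm (projLinearMap hW Φ) ≤ C * ‖Φ‖ := by
  obtain ⟨C, hC, hkernel⟩ := hW.exists_integral_norm_derivKernel_le hD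
  have seminorm_le : ∀ (Φ : Lp ℂ ∞ dA) (z : Disk), (1 - ‖(z : ℂ)‖ ^ 2)
      * ‖derivative (projLinearMap hW Φ) z‖ ≤ 2 * C * ‖Φ‖ := fun Φ z => by
    have hz := norm_coe_lt_one z
    have := norm_nonneg (z : ℂ)
    have hsub : 0 < 1 - ‖(z : ℂ)‖ := sub_pos.2 hz
    calc _ ≤ (2 * (1 - ‖(z : ℂ)‖)) * (‖Φ‖ * (C / (1 - ‖(z : ℂ)‖))) :=
          mul_le_mul (by nlinarith) ((norm_derivative_projLinearMap_le hW Φ z).trans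
            (mul_le_mul_of_nonneg_left (hkernel z hz) (norm_nonneg Φ))) (norm_nonneg _)
            (by positivity)
      _ = 2 * C * ‖Φ‖ := by field_simp
  refine ⟨2 * C + kernelCoeff W 0 * ∫ ξ : Disk, W ‖(ξ : ℂ)‖ ∂dA, fun Φ => ⟨?_, ?_⟩⟩
  · exact ⟨2 * C * ‖Φ‖, forall_mem_range.2 (seminorm_le Φ)⟩
  · have : Nonempty Disk := ⟨origin⟩
    rw [blochNorm, add_mul]
    exact add_le_add (ciSup_le (seminorm_le Φ)) (norm_projLinearMap_origin_le hW Φ)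

end Projection

section FracDerivBound

variable {W V : ℝ → ℝ} {α : ℝ} {h : Hol}

theorem moment_one_sub_sq (n : ℕ) :
    moment (fun r => 1 - r ^ 2) (2 * n + 1) = (2 * ((n : ℝ) + 1) * (n + 2))⁻¹ := by
  have expand : ∀ r : ℝ, r ^ (2 * n + 1) * (1 - r ^ 2) = r ^ (2 * n + 1) - r ^ (2 * n + 3) :=
    fun r => by ring
  simp only [moment, expand]
  rw [intervalIntegral.integral_sub (by simp) (by simp), integral_pow, integral_pow]
  push_cast
  field_simp
  norm_num
  field_simp
  ring

theorem fracKernelCoeff_mul_integral (hW : IsRadialWeight W) (hV : IsRadialWeight V)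
    (hi : Integrable (fun ξ : Disk => ((1 - ‖(ξ : ℂ)‖ ^ 2 : ℝ) : ℂ) * derivative h ξ) dA)
    (n : ℕ) :
    (fracKernelCoeff W V n : ℂ) * ∫ ξ : Disk,
      ((1 - ‖(ξ : ℂ)‖ ^ 2 : ℝ) : ℂ) * derivative h ξ * conj (ξ : ℂ) ^ n ∂dA
      = coeff (fracDeriv W V h) (n + 1) := by
  have hi := integrable_mul_conj_pow hi n
  simp only [← seriesEval_derivative, mul_assoc, mul_comm ((1 - _ : ℝ) : ℂ)] at hi ⊢
  simp only [← mul_assoc] at hi ⊢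
  rw [integral_seriesEval_mul_conj_pow (W := fun r => 1 - r ^ 2) (summableOnDisk_derivative h) n
    hi, moment_one_sub_sq, coeff_fracDeriv hW hV, fracKernelCoeff]
  have hn1 : (n : ℂ) + 1 ≠ 0 := by exact_mod_cast n.succ_ne_zero
  have hn2 : (n : ℂ) + 2 ≠ 0 := by exact_mod_cast (n + 1).succ_ne_zero
  push_cast
  field_simp

theorem fracDeriv_apply (hW : IsRadialWeight W) (hV : IsRadialWeight V)
    (hi : Integrable (fun ξ : Disk => ((1 - ‖(ξ : ℂ)‖ ^ 2 : ℝ) : ℂ) * derivative h ξ) dA)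
    (z : Disk) :
    fracDeriv W V h z = fracDeriv W V h origin
      + z * ∫ ξ : Disk, ((1 - ‖(ξ : ℂ)‖ ^ 2 : ℝ) : ℂ) * derivative h ξ
        * seriesEval (fun n => (fracKernelCoeff W V n : ℂ)) ((z : ℂ) * conj (ξ : ℂ)) ∂dA := by
  have integral_expansion := (hasSum_integral_mul_seriesEval hi
    (summableOnDisk_fracKernelCoeff hW hV) (norm_coe_lt_one z)).mul_left (z : ℂ)
  have taylor := (hasSum_nat_add_iff' 1).2 (hasSum_coeff (fracDeriv W V h) z)
  simp only [Finset.sum_range_one, pow_zero, mul_one, coeff_zero] at taylor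
  refine eq_add_of_sub_eq' (taylor.unique (integral_expansion.congr_fun fun n => ?_))
  rw [fracKernelCoeff_mul_integral hW hV hi]
  ring

theorem MemBloch.exists_norm_mul_derivative_le (hh : MemBloch h) :
    ∃ M : ℝ, ∀ ξ : Disk, ‖((1 - ‖(ξ : ℂ)‖ ^ 2 : ℝ) : ℂ) * derivative h ξ‖ ≤ M := by
  obtain ⟨M, hM⟩ := hh
  refine ⟨M, fun ξ => ?_⟩
  have hξ : 0 ≤ 1 - ‖(ξ : ℂ)‖ ^ 2 :=
    sub_nonneg.2 (pow_le_one₀ (norm_nonneg _) (norm_coe_lt_one ξ).le)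
  rw [norm_mul, Complex.norm_real, Real.norm_of_nonneg hξ]
  exact hM ⟨ξ, rfl⟩

theorem IsDoublingWeight.exists_norm_fracDeriv_le (hW : IsDoublingWeight W) (hα : 0 < α)
    (hh : MemBloch h) :
    ∃ A B : ℝ, 0 ≤ A ∧ ∀ z : Disk,
      ‖fracDeriv W (powWeight W α) h z‖ ≤ A + B * (1 - ‖(z : ℂ)‖) ^ (-α) := by
  obtain ⟨M, hM⟩ := hh.exists_norm_mul_derivative_le
  obtain ⟨C, -, hkernel⟩ := hW.exists_integral_norm_fracKernel_le hα
  have hM0 : 0 ≤ M := (norm_nonneg _).trans (hM origin)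
  have hR := hW.radialWeight
  have hV := hR.powWeight hα.le
  have hi : Integrable (fun ξ : Disk => ((1 - ‖(ξ : ℂ)‖ ^ 2 : ℝ) : ℂ) * derivative h ξ) dA := by
    have := continuous_derivative h
    exact Integrable.of_bound (Continuous.aestronglyMeasurable (by fun_prop)) M (.of_forall hM)
  refine ⟨‖fracDeriv W (powWeight W α) h origin‖, M * C, norm_nonneg _, fun z => ?_⟩
  have hz := norm_coe_lt_one z
  have integral_le := norm_integral_mul_seriesEval_le (summableOnDisk_fracKernelCoeff hR hV)
    (W := fun _ => 1) (integrable_const 1) hz (M := M) (.of_forall fun ξ => by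
      simpa only [mul_one] using hM ξ)
  simp only [mul_one] at integral_le
  rw [fracDeriv_apply hR hV hi]
  refine (norm_add_le _ _).trans (add_le_add_right ?_ _)
  rw [norm_mul, mul_assoc]
  exact (mul_le_of_le_one_left (norm_nonneg _) hz.le).trans
    (integral_le.trans (mul_le_mul_of_nonneg_left (hkernel z hz) hM0))

theorem IsDoublingWeight.exists_norm_gFun_le (hW : IsDoublingWeight W) (hα : 0 < α)
    (hh : MemBloch h) : ∃ C : ℝ, ∀ z : Disk, ‖gFun W α h z‖ ≤ C := by
  obtain ⟨A, B, hA, hbound⟩ := hW.exists_norm_fracDeriv_le hα hh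
  refine ⟨A + B, fun z => ?_⟩
  have hsub : 0 < 1 - ‖(z : ℂ)‖ := sub_pos.2 (norm_coe_lt_one z)
  have hpow : 0 < (1 - ‖(z : ℂ)‖) ^ α := Real.rpow_pos_of_pos hsub _
  have hpow1 : (1 - ‖(z : ℂ)‖) ^ α ≤ 1 :=
    Real.rpow_le_one hsub.le (sub_le_self _ (norm_nonneg _)) hα.le
  rw [gFun, norm_mul, Complex.norm_real, Real.norm_of_nonneg hpow.le]
  calc _ ≤ (1 - ‖(z : ℂ)‖) ^ α * (A + B * (1 - ‖(z : ℂ)‖) ^ (-α)) :=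
        mul_le_mul_of_nonneg_left (hbound z) hpow.le
    _ = (1 - ‖(z : ℂ)‖) ^ α * A + B := by
        rw [Real.rpow_neg hsub.le]
        field_simp
    _ ≤ A + B := by linarith [mul_le_of_le_one_left hA hpow1]

theorem continuous_gFun (hα : 0 ≤ α) (h : Hol) : Continuous (gFun W α h) :=
  (Complex.continuous_ofReal.comp ((continuous_one_sub_rpow hα).comp
    (continuous_norm.comp continuous_subtype_val))).mul (fracDeriv W (powWeight W α) h).1.continuous

theorem IsDoublingWeight.memLp_gFun (hW : IsDoublingWeight W) (hα : 0 < α) (hh : MemBloch h) :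
    MemLp (gFun W α h) ∞ dA := by
  obtain ⟨C, hC⟩ := hW.exists_norm_gFun_le hα hh
  exact memLp_top_of_bound (continuous_gFun hα.le h).aestronglyMeasurable C (.of_forall hC)

theorem gFun_mul_eq (ξ : Disk) :
    gFun W α h ξ * (W ‖(ξ : ℂ)‖ : ℂ)
      = fracDeriv W (powWeight W α) h ξ * (powWeight W α ‖(ξ : ℂ)‖ : ℂ) := by
  rw [gFun, powWeight]
  push_cast
  ring

theorem IsRadialWeight.bergmanProj_gFun (hW : IsRadialWeight W) (hα : 0 ≤ α)
    (hg : MemLp (gFun W α h) ∞ dA) (z : Disk) : bergmanProj W (gFun W α h) z = h z := by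
  have hV := hW.powWeight hα
  have hi := hW.integrable_mul_of_memLp_top hg
  have expansion := hW.hasSum_bergmanProj hi z
  simp only [gFun_mul_eq] at hi expansion
  refine expansion.unique ((hasSum_coeff h z).congr_fun fun n => ?_)
  have hne : (multiplier W (powWeight W α) n : ℂ) ≠ 0 := by
    exact_mod_cast (div_pos (hW.moment_pos _) (hV.moment_pos _)).ne'
  congr 1
  refine mul_left_cancel₀ hne ?_
  rw [← mul_assoc, multiplier_mul_kernelCoeff hW, hV.kernelCoeff_mul_integral_eq_coeff hi,
    coeff_fracDeriv hW hV]

theorem bergmanProj_congr_ae {φ ψ : Disk → ℂ} (hφψ : φ =ᵐ[dA] ψ) (z : Disk) :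
    bergmanProj W φ z = bergmanProj W ψ z :=
  integral_congr_ae (hφψ.mono fun ξ hξ => by simp only [projIntegrand, hξ])

end FracDerivBound

end BergmanBloch

end

theorem theorem4p1 (ω : ℝ → ℝ) (hω : IsDoublingWeight ω) :
    (∃ P : Lp ℂ ∞ dA →ₗ[ℂ] Hol,
      (∀ (Φ : Lp ℂ ∞ dA) (z : Disk),
        Integrable (projIntegrand ω Φ z) dA ∧ P Φ z = bergmanProj ω Φ z) ∧
      (∃ C : ℝ, ∀ Φ : Lp ℂ ∞ dA, MemBloch (P Φ) ∧ blochNorm (P Φ) ≤ C * ‖Φ‖) ∧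
      (∀ h : Hol, MemBloch h → ∃ Φ : Lp ℂ ∞ dA, P Φ = h)) ∧
    ∀ α : ℝ, 0 < α → ∀ h : Hol, MemBloch h →
      MemLp (gFun ω α h) ∞ dA ∧ ∀ z : Disk, bergmanProj ω (gFun ω α h) z = h z := by
  have hW := hω.radialWeight
  obtain ⟨D, hD⟩ := hW.exists_doublingMoments hω.upper
  have onto : ∀ h : Hol, MemBloch h → ∃ Φ, projLinearMap hW Φ = h := fun h hh => by
    have hg := hω.memLp_gFun one_pos hh
    refine ⟨hg.toLp _, hol_ext fun z => ?_⟩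
    rw [projLinearMap_apply, bergmanProj_congr_ae hg.coeFn_toLp,
      hW.bergmanProj_gFun zero_le_one hg]
  refine ⟨⟨projLinearMap hW, fun Φ z => ⟨?_, projLinearMap_apply hW Φ z⟩,
    exists_blochNorm_projLinearMap_le hW hD, onto⟩, fun α hα h hh => ?_⟩
  · exact hW.integrable_projIntegrand (hW.integrable_Lp_mul Φ) z
  · have hg := hω.memLp_gFun hα hh
    exact ⟨hg, hW.bergmanProj_gFun hα.le hg⟩
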